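/- Let $n,m\ge 1$ and let $H=(-1)^m\sum_{|\alpha|=2m}a_\alpha D^\alpha$, where $D^\alpha=\partial_{x_1}^{\alpha_1}\cdots\partial_{x_n}^{\alpha_n}$, be a homogeneous differential operator of order $2m$ on $\mathbb{R}^n$ with real constant coefficients $a_\alpha$. Assume that $H$ is elliptic, i.e. that its symbol $H(\xi)=\sum_{|\alpha|=2m}a_\alpha\xi^\alpha$ satisfies $H(\xi)>0$ for all $\xi\in\mathbb{R}^n\setminus\{0\}$. Put $$F_H(\xi)=H(\xi)^{1/(2m)},\qquad F_H^*(\omega)=\sup_{\xi\neq 0}\frac{\omega\cdot\xi}{F_H(\xi)}\qquad(\xi,\omega\in\mathbb{R}^n).$$ For a unit vector $\nu\in S^{n-1}$ let $\mathbf{H}^n_\nu=\{x\in\mathbb{R}^n:\nu\cdot x>0\}$ and let $$d_H(x)=\min\{F_H^*(x-y):y\in\partial\mathbf{H}^n_\nu\},\qquad x\in\mathbf{H}^n_\nu,$$ be the Finsler distance to the boundary of the half-space. Finally let $$A(m)=\frac{\big((2m-1)!!\big)^2}{4^m}=\frac{(2m-1)^2(2m-3)^2\cdots 1^2}{4^m}.$$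 Then for every $\nu\in S^{n-1}$ and every real-valued $u\in C_c^\infty(\mathbf{H}^n_\nu)$ both integrals below are finite and $$\int_{\mathbf{H}^n_\nu}u(x)\,Hu(x)\,dx\;\ge\;A(m)\int_{\mathbf{H}^n_\nu}\frac{u^2(x)}{d_H^{2m}(x)}\,dx .$$ Moreover, if $F_H$ is a convex function, then the constant $A(m)$ is optimal for every half-space: for each $\nu\in S^{n-1}$, if $C\in\mathbb{R}$ is such that $\int_{\mathbf{H}^n_\nu}u\,Hu\,dx\ge C\int_{\mathbf{H}^n_\nu}u^2/d_H^{2m}\,dx$ for all $u\in C_c^\infty(\mathbf{H}^n_\nu)$, then $C\le A(m)$. -/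

import Mathlib

open MeasureTheory Set

noncomputable section

namespace FinslerRellich

/-- The partial derivative `∂f/∂xᵢ` on `ℝⁿ`. -/
def partialDeriv {n : ℕ} (i : Fin n) (f : EuclideanSpace ℝ (Fin n) → ℝ) :
    EuclideanSpace ℝ (Fin n) → ℝ :=
  fun x => lineDeriv ℝ f x (EuclideanSpace.single i 1)

/-- The iterated partial derivative `D^α f = ∂₁^{α₁} (∂₂^{α₂} (⋯ ∂ₙ^{αₙ} f))`. -/
def multiDeriv {n : ℕ} (α : Fin n → ℕ) (f : EuclideanSpace ℝ (Fin n) → ℝ) :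
    EuclideanSpace ℝ (Fin n) → ℝ :=
  (List.finRange n).foldr (fun i g => (partialDeriv i)^[α i] g) f

/-- The multi-indices `α ∈ ℕⁿ` with `|α| = 2m`. -/
def multiIndices (n m : ℕ) : Finset (Fin n → ℕ) :=
  Finset.piAntidiag Finset.univ (2 * m)

/-- The operator `H = (-1)^m ∑_{|α| = 2m} a_α D^α` with real constant coefficients `a_α`
(the values of `a` at other multi-indices play no role). -/
def operator {n : ℕ} (m : ℕ) (a : (Fin n → ℕ) → ℝ) (u : EuclideanSpace ℝ (Fin n) → ℝ) :
    EuclideanSpace ℝ (Fin n) → ℝ :=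
  fun x => (-1) ^ m * ∑ α ∈ multiIndices n m, a α * multiDeriv α u x

/-- The symbol `H(ξ) = ∑_{|α| = 2m} a_α ξ^α`. -/
def symbol {n : ℕ} (m : ℕ) (a : (Fin n → ℕ) → ℝ) (ξ : EuclideanSpace ℝ (Fin n)) : ℝ :=
  ∑ α ∈ multiIndices n m, a α * ∏ i, ξ i ^ α i

/-- Ellipticity: the symbol is positive away from the origin. -/
def IsElliptic {n : ℕ} (m : ℕ) (a : (Fin n → ℕ) → ℝ) : Prop :=
  ∀ ξ : EuclideanSpace ℝ (Fin n), ξ ≠ 0 → 0 < symbol m a ξ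

/-- `F_H(ξ) = H(ξ)^{1/(2m)}`. -/
def finsler {n : ℕ} (m : ℕ) (a : (Fin n → ℕ) → ℝ) (ξ : EuclideanSpace ℝ (Fin n)) : ℝ :=
  symbol m a ξ ^ (1 / (2 * (m : ℝ)))

/-- The Finsler norm `F_H^*(ω) = sup_{ξ ≠ 0} (ω ⬝ ξ) / F_H(ξ)`. -/
def finslerDual {n : ℕ} (m : ℕ) (a : (Fin n → ℕ) → ℝ) (ω : EuclideanSpace ℝ (Fin n)) : ℝ :=
  ⨆ ξ : {ξ : EuclideanSpace ℝ (Fin n) // ξ ≠ 0},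
    inner ℝ ω (ξ : EuclideanSpace ℝ (Fin n)) / finsler m a ξ

/-- The Finsler distance `d_H(x) = inf {F_H^*(x - y) : y ∈ ∂Ω}` to the boundary of `Ω`. -/
def finslerDist {n : ℕ} (m : ℕ) (a : (Fin n → ℕ) → ℝ) (Ω : Set (EuclideanSpace ℝ (Fin n)))
    (x : EuclideanSpace ℝ (Fin n)) : ℝ :=
  sInf ((fun y => finslerDual m a (x - y)) '' frontier Ω)

/-- The open half-space `{x : ν ⬝ x > 0}`. -/
def halfSpace {n : ℕ} (ν : EuclideanSpace ℝ (Fin n)) :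
    TopologicalSpace.Opens (EuclideanSpace ℝ (Fin n)) where
  carrier := {x | 0 < inner ℝ ν x}
  is_open' := isOpen_lt continuous_const (continuous_const.inner continuous_id)

/-- The constant `A(m) = ((2m-1)!!)² / 4^m`. -/
def rellichConst (m : ℕ) : ℝ :=
  (Nat.doubleFactorial (2 * m - 1) : ℝ) ^ 2 / 4 ^ m

end FinslerRellich

end

/-! The inequality is first proved with the Euclidean distance `ν ⬝ x` and constant `A(m) H(ν)`. The
Fourier transform along the boundary hyperplane turns `H`, at each frequency `ξ`, into an ordinary
differential operator `p(P)` on the half-line. Here `P = -i d/dt` and `p(s) = H(2πξ + sν)` is a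
nonnegative real polynomial of degree `2m` whose leading coefficient is `H(ν)`, whatever `ξ` is.
After normalisation, `p` splits into factors `|s - z|²` with `Im z ≥ 0`. Each of them is removed by
integrating by parts, and then costs one Hardy inequality with a power weight (`weighted_hardy`).
The Hardy constants `((2k+1)/2)²` for `k < m` multiply to `A(m)` (`rellich_line`), and Plancherel
reassembles the frequencies (`rellich_halfSpace`).

By homogeneity `d_H(x) = (ν ⬝ x) d_H(ν)` (`finslerDist_eq`). Testing the supremum in `F_H^*` at `ξ =
ν` gives `d_H(ν) ≥ 1 / F_H(ν)`, so `d_H(ν)^(-2m) ≤ H(ν)` and the stated inequality follows. If `F_H`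
is convex, Hahn–Banach provides a supporting functional at `ν`, and this bound is an equality
(`finslerDist_normal`).

For optimality, an inequality with constant `K` is applied to functions stretched along the
hyperplane. In the limit only the normal part `(-1)^m H(ν) ∂_ν^(2m)` survives, and a product
function reduces matters to the half-line (`line_inequality`). There `ψ(t) = t^(m-1/2) f(log t)`
transforms the weighted norm into `∫ f²` and `d^(2m)/dt^(2m)` into a constant-coefficient operator
`q(d/ds)`. Spreading `f` out leaves only `q(0) = (-1)^m A(m)` (`le_rellichConst_of_line`). -/

noncomputable section

namespace FinslerRellich

open scoped Distributions ContDiff ComplexConjugate FourierTransform Pointwise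
open Polynomial (X C aeval)

/-! ### Constant-coefficient operators as expressions in an algebra. -/

section Algebra

variable {n : ℕ} {A B : Type*} [Ring A] [Algebra ℝ A] [Ring B] [Algebra ℝ B]

/-- The operator `(-1)^m ∑ a_α d^α` built from elements `d i` of an algebra. -/
def opIn (m : ℕ) (a : (Fin n → ℕ) → ℝ) (d : Fin n → A) : A :=
  (-1) ^ m * ∑ α ∈ multiIndices n m, a α • ((List.finRange n).map (fun i => d i ^ α i)).prod

theorem map_opIn (φ : A →ₐ[ℝ] B) (m : ℕ) (a : (Fin n → ℕ) → ℝ) (d : Fin n → A) :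
    φ (opIn m a d) = opIn m a (fun i => φ (d i)) := by
  simp [opIn, map_list_prod, List.map_map, Function.comp_def]

theorem opIn_comm {A : Type*} [CommRing A] [Algebra ℝ A] (m : ℕ) (a : (Fin n → ℕ) → ℝ)
    (d : Fin n → A) :
    opIn m a d = (-1) ^ m * ∑ α ∈ multiIndices n m, a α • ∏ i, d i ^ α i := by
  simp [opIn, Fin.prod_univ_def]

/-- The operator is homogeneous of degree `2m`. -/
theorem opIn_smul {A : Type*} [CommRing A] [Algebra ℝ A] (m : ℕ) (a : (Fin n → ℕ) → ℝ)
    (c : A) (d : Fin n → A) :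
    opIn m a (fun i => c * d i) = c ^ (2 * m) * opIn m a d := by
  rw [opIn_comm, opIn_comm, mul_left_comm (c ^ (2 * m))]
  refine congrArg _ ?_
  rw [Finset.mul_sum]
  refine Finset.sum_congr rfl fun α hα => ?_
  have : ∑ i, α i = 2 * m := by
    simpa [multiIndices] using hα
  rw [mul_smul_comm, ← this, ← Finset.prod_pow_eq_pow_sum, ← Finset.prod_mul_distrib]
  simp [mul_pow]

theorem opIn_real (m : ℕ) (a : (Fin n → ℕ) → ℝ) (ξ : EuclideanSpace ℝ (Fin n)) :
    opIn m a (fun i => ξ i) = (-1) ^ m * symbol m a ξ := by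
  rw [opIn_comm]; simp [symbol]

/-- The transfer principle used for both the partial Fourier transform and linear changes of
variable: only the generators have to be checked. The scalars on the target may be larger, since
real functions are sent to complex ones by the Fourier transform. -/
theorem intertwine_opIn {𝕜 M N : Type*} [RCLike 𝕜] [AddCommGroup M] [Module ℝ M]
    [AddCommGroup N] [Module ℝ N] [Module 𝕜 N] [IsScalarTower ℝ 𝕜 N] (T : M →ₗ[ℝ] N) (m : ℕ)
    (a : (Fin n → ℕ) → ℝ)
    (d : Fin n → Module.End ℝ M) (d' : Fin n → Module.End 𝕜 N)
    (h : ∀ i f, T (d i f) = d' i (T f)) (f : M) :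
    T (opIn m a d f) = opIn m a d' (T f) := by
  have hpow : ∀ i k f, T ((d i ^ k) f) = (d' i ^ k) (T f) := by
    intro i k
    induction k with
    | zero => simp
    | succ k ih => intro f; simp [pow_succ, ih, h]
  have hprod : ∀ (α : Fin n → ℕ) (l : List (Fin n)) f,
      T ((l.map (fun i => d i ^ α i)).prod f) = (l.map (fun i => d' i ^ α i)).prod (T f) := by
    intro α l
    induction l with
    | nil => simp
    | cons i l ih => intro f; simp [ih, hpow]
  have hneg : ∀ g, T (((-1 : Module.End ℝ M) ^ m) g) = ((-1 : Module.End 𝕜 N) ^ m) (T g) := by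
    intro g
    rcases neg_one_pow_eq_or (Module.End ℝ M) m with hm | hm <;>
    rcases Nat.even_or_odd m with h' | h' <;> simp [h'.neg_one_pow]
  simp only [opIn, Module.End.mul_apply, hneg, LinearMap.sum_apply, map_sum, LinearMap.smul_apply,
    LinearMap.map_smul_of_tower, hprod]

/-- `ε ↦ opIn (ε A_i + B_i)` is continuous against every linear functional. -/
theorem continuous_opIn (m : ℕ) (a : (Fin n → ℕ) → ℝ) (d e : Fin n → A) (L : A →ₗ[ℝ] ℝ) :
    Continuous fun ε : ℝ => L (opIn m a (fun i => ε • d i + e i)) := by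
  have h1 : ∀ (i : Fin n) (f : ℝ → A), (∀ L : A →ₗ[ℝ] ℝ, Continuous fun ε => L (f ε)) →
      ∀ L : A →ₗ[ℝ] ℝ, Continuous fun ε => L (f ε * (ε • d i + e i)) := by
    intro i f hf L
    have h1 := hf (L ∘ₗ LinearMap.mulRight ℝ (d i))
    have h2 := hf (L ∘ₗ LinearMap.mulRight ℝ (e i))
    simp only [LinearMap.comp_apply, LinearMap.mulRight_apply] at h1 h2
    simp only [mul_add, mul_smul_comm, map_add, map_smul, smul_eq_mul]
    exact (continuous_id.mul h1).add h2
  have h2 : ∀ (i : Fin n) (k : ℕ) (f : ℝ → A), (∀ L : A →ₗ[ℝ] ℝ, Continuous fun ε => L (f ε)) →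
      ∀ L : A →ₗ[ℝ] ℝ, Continuous fun ε => L (f ε * (ε • d i + e i) ^ k) := by
    intro i k f hf
    induction k with
    | zero => simpa using hf
    | succ k ih =>
      have := h1 i _ ih
      simpa [pow_succ, mul_assoc] using this
  have h3 : ∀ (α : Fin n → ℕ) (l : List (Fin n)) (f : ℝ → A),
      (∀ L : A →ₗ[ℝ] ℝ, Continuous fun ε => L (f ε)) → ∀ L : A →ₗ[ℝ] ℝ,
      Continuous fun ε => L (f ε * (l.map (fun i => (ε • d i + e i) ^ α i)).prod) := by
    intro α l
    induction l with
    | nil => intro f hf; simpa using hf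
    | cons i l ih =>
      intro f hf
      have := ih _ (h2 i (α i) f hf)
      simpa [mul_assoc] using this
  simp only [opIn, Finset.mul_sum, map_sum]
  refine continuous_finsetSum _ fun α _ => ?_
  simp only [mul_smul_comm, map_smul]
  exact continuous_const.mul (h3 α _ (fun _ => (-1) ^ m) (fun L => continuous_const) L)

end Algebra

/-! ### Directional derivatives acting on test functions. -/

section TestFunctions

variable {E : Type*} [NormedAddCommGroup E] [NormedSpace ℝ E] {Ω : TopologicalSpace.Opens E}
  {F : Type*} [NormedAddCommGroup F] [NormedSpace ℝ F]

/-- The directional derivative as a linear operator on test functions. -/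
def dir (𝕜 : Type*) [RCLike 𝕜] [NormedSpace 𝕜 F] (v : E) : Module.End 𝕜 𝓓(Ω, F) :=
  (TestFunction.lineDerivCLM 𝕜 v : 𝓓(Ω, F) →L[𝕜] 𝓓(Ω, F)).toLinearMap

variable {𝕜 : Type*} [RCLike 𝕜] [NormedSpace 𝕜 F]

theorem differentiable_test (f : 𝓓(Ω, F)) : Differentiable ℝ f :=
  f.contDiff.differentiable (by simp)

theorem dir_apply (v : E) (f : 𝓓(Ω, F)) (x : E) :
    dir 𝕜 v f x = lineDeriv ℝ f x v := by
  have := TestFunction.lineDerivCLM_apply_of_le (𝕜 := 𝕜) (f := f) (v := v) (x := x) (k := ⊤)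
    (by simp)
  exact this

theorem dir_eq_fderiv (v : E) (f : 𝓓(Ω, F)) (x : E) :
    dir 𝕜 v f x = fderiv ℝ f x v := by
  rw [dir_apply, (differentiable_test f x).lineDeriv_eq_fderiv]

theorem dir_add_smul (c : ℝ) (v w : E) :
    (dir ℝ (c • v + w) : Module.End ℝ 𝓓(Ω, F)) = c • dir ℝ v + dir ℝ w := by
  ext f x
  simp [dir_eq_fderiv]

theorem multiDeriv_eq {n : ℕ} {Ω : TopologicalSpace.Opens (EuclideanSpace ℝ (Fin n))}
    (α : Fin n → ℕ) (f : 𝓓(Ω, ℝ)) :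
    multiDeriv α f = ((List.finRange n).map
      (fun i => (dir ℝ (EuclideanSpace.single i 1) : Module.End ℝ 𝓓(Ω, ℝ)) ^ α i)).prod f := by
  have h1 : ∀ (i : Fin n) (k : ℕ) (f : 𝓓(Ω, ℝ)), (partialDeriv i)^[k] f =
      ((dir ℝ (EuclideanSpace.single i 1) : Module.End ℝ 𝓓(Ω, ℝ)) ^ k) f := by
    intro i k
    induction k with
    | zero => simp
    | succ k ih =>
      intro f
      rw [Function.iterate_succ_apply, pow_succ, Module.End.mul_apply, ← ih]
      congr 1
      ext x
      rw [dir_apply]; rfl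
  unfold multiDeriv
  induction List.finRange n with
  | nil => simp
  | cons i l ih => simp [ih, h1]

theorem operator_eq {n : ℕ} {Ω : TopologicalSpace.Opens (EuclideanSpace ℝ (Fin n))}
    (m : ℕ) (a : (Fin n → ℕ) → ℝ) (f : 𝓓(Ω, ℝ)) :
    operator m a f = opIn m a (fun i => (dir ℝ (EuclideanSpace.single i 1) :
      Module.End ℝ 𝓓(Ω, ℝ))) f := by
  ext x
  simp only [operator, opIn, multiDeriv_eq, Module.End.mul_apply, LinearMap.sum_apply,
    LinearMap.smul_apply]
  rcases Nat.even_or_odd m with h | h <;>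
    simp [h.neg_one_pow, sum_apply]

/-- A continuous function against a function continuous near its support. -/
theorem continuous_mul_of_tsupport {E : Type*} [TopologicalSpace E] {f g : E → ℝ}
    {U : Set E} (hU : IsOpen U) (hf : Continuous f) (hs : tsupport f ⊆ U)
    (hg : ContinuousOn g U) : Continuous fun x => f x * g x := by
  refine continuous_of_tsupport fun x hx => ?_
  have hxU : x ∈ U := hs (closure_mono (Function.support_mul_subset_left f g) hx)
  exact hf.continuousAt.mul (hg.continuousAt (hU.mem_nhds hxU))

end TestFunctions

theorem integrable_mul_of_tsupport {E : Type*} [TopologicalSpace E] [MeasurableSpace E]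
    [OpensMeasurableSpace E] {μ : Measure E} [IsFiniteMeasureOnCompacts μ] {f g : E → ℝ}
    {U : Set E} (hU : IsOpen U) (hf : Continuous f) (hc : HasCompactSupport f)
    (hs : tsupport f ⊆ U) (hg : ContinuousOn g U) : Integrable (fun x => f x * g x) μ :=
  (continuous_mul_of_tsupport hU hf hs hg).integrable_of_hasCompactSupport hc.mul_right

/-- The positive half-line. -/
def posReals : TopologicalSpace.Opens ℝ := ⟨Ioi 0, isOpen_Ioi⟩

theorem integrable_div_pow {φ : ℝ → ℝ} (hf : Continuous φ) (hc : HasCompactSupport φ)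
    (hs : tsupport φ ⊆ Ioi 0) (k : ℕ) : Integrable fun t => φ t / t ^ k := by
  simp only [div_eq_mul_inv]
  refine integrable_mul_of_tsupport isOpen_Ioi hf hc hs ?_
  exact (continuousOn_id.pow k).inv₀ fun t ht => pow_ne_zero _ (ne_of_gt ht)

theorem integrable_norm_sq_div_pow {F : Type*} [NormedAddCommGroup F] [NormedSpace ℝ F]
    (f : 𝓓(posReals, F)) (k : ℕ) :
    Integrable fun t => ‖f t‖ ^ 2 / t ^ k := by
  refine integrable_div_pow (φ := fun t => ‖f t‖ ^ 2) (by fun_prop) ?_ ?_ k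
  · exact f.hasCompactSupport.comp_left (g := fun z => ‖z‖ ^ 2) (by simp)
  · exact (tsupport_comp_subset (g := fun z : F => ‖z‖ ^ 2) (by simp) f).trans f.tsupport_subset

theorem integrable_mul_test {E : Type*} [NormedAddCommGroup E] [NormedSpace ℝ E]
    [MeasurableSpace E] [OpensMeasurableSpace E] {μ : Measure E} [IsFiniteMeasureOnCompacts μ]
    {Ω : TopologicalSpace.Opens E} (f g : 𝓓(Ω, ℝ)) :
    Integrable (fun x => f x * g x) μ :=
  (f.continuous.mul g.continuous).integrable_of_hasCompactSupport g.hasCompactSupport.mul_left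

theorem integrable_conj_mul {E : Type*} [NormedAddCommGroup E] [NormedSpace ℝ E]
    [MeasurableSpace E] [OpensMeasurableSpace E] {μ : Measure E} [IsFiniteMeasureOnCompacts μ]
    {Ω : TopologicalSpace.Opens E} (f g : 𝓓(Ω, ℂ)) :
    Integrable (fun t => conj (f t) * g t) μ := by
  refine Continuous.integrable_of_hasCompactSupport ?_ g.hasCompactSupport.mul_left
  exact (Complex.continuous_conj.comp f.continuous).mul g.continuous

/-! ### The momentum operator on the line and its factorisation. -/

section Line

variable {Ω : TopologicalSpace.Opens ℝ}

theorem dir_one_apply {𝕜 F : Type*} [RCLike 𝕜] [NormedAddCommGroup F] [NormedSpace ℝ F]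
    [NormedSpace 𝕜 F] (f : 𝓓(Ω, F)) (t : ℝ) :
    dir 𝕜 (1 : ℝ) f t = deriv f t := by
  rw [dir_eq_fderiv]; simp

/-- The momentum operator `-i d/dt`. -/
def momentum (Ω : TopologicalSpace.Opens ℝ) : Module.End ℂ 𝓓(Ω, ℂ) := (-Complex.I) • dir ℂ (1 : ℝ)

theorem momentum_apply (f : 𝓓(Ω, ℂ)) (t : ℝ) : momentum Ω f t = -Complex.I * deriv f t := by
  simp [momentum, smul_apply, dir_one_apply]

theorem hasDerivAt_test {F : Type*} [NormedAddCommGroup F] [NormedSpace ℝ F]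
    (f : 𝓓(Ω, F)) (t : ℝ) : HasDerivAt f (deriv f t) t :=
  (differentiable_test f t).hasDerivAt

/-- Symmetry of `-i d/dt`: integration by parts has no boundary terms, and its minus sign is
absorbed by the conjugate of `-i`. -/
theorem integral_conj_momentum (f g : 𝓓(Ω, ℂ)) :
    ∫ t, conj (f t) * momentum Ω g t = ∫ t, conj (momentum Ω f t) * g t := by
  have h1 : ∀ t, HasDerivAt (fun t => conj (f t)) (conj (deriv f t)) t := fun t =>
    (hasDerivAt_test f t).star_conj
  have e1 : ∀ h : 𝓓(Ω, ℂ), deriv h = dir ℂ (1 : ℝ) h := fun h => by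
    ext t; rw [dir_one_apply]
  have := integral_mul_deriv_eq_deriv_mul_of_integrable (u := fun t => conj (f t)) (v := g)
    (u' := fun t => conj (deriv f t)) (v' := deriv g) (fun t _ => h1 t)
    (fun t _ => hasDerivAt_test g t)
    (by rw [e1]; exact integrable_conj_mul f _) (by rw [e1]; exact integrable_conj_mul _ g)
    (integrable_conj_mul f g)
  simp only [momentum_apply, map_mul, map_neg, Complex.conj_I, neg_neg]
  simp only [mul_left_comm _ (-Complex.I), mul_assoc]
  rw [integral_const_mul, integral_const_mul, this]
  simp

theorem integral_conj_momentum_sub (z : ℂ) (f g : 𝓓(Ω, ℂ)) :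
    ∫ t, conj (f t) * (momentum Ω - (conj z) • 1) g t =
      ∫ t, conj ((momentum Ω - z • 1) f t) * g t := by
  simp only [LinearMap.sub_apply, sub_apply, LinearMap.smul_apply, smul_apply, Module.End.one_apply,
    mul_sub, map_sub, sub_mul, smul_eq_mul, map_mul]
  rw [integral_sub, integral_sub, integral_conj_momentum]
  · congr 2; ext t; ring
  · exact integrable_conj_mul _ _
  · simpa [mul_assoc] using (integrable_conj_mul f g).const_mul (conj z)
  · exact integrable_conj_mul _ _
  · simpa [mul_left_comm] using (integrable_conj_mul f g).const_mul (conj z)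

/-- With `z = a + bi` this is `(s - a)² + b² = (s - z̄)(s - z)`. By the preceding lemma the two
factors are formal adjoints of each other. -/
theorem aeval_momentum_quadratic (a b : ℝ) :
    aeval (momentum Ω) ((X - C a) ^ 2 + C (b ^ 2)) =
      (momentum Ω - (conj (a + b * Complex.I : ℂ)) • 1) *
        (momentum Ω - (a + b * Complex.I : ℂ) • 1) := by
  have h : ∀ r : ℝ, algebraMap ℝ (Module.End ℂ 𝓓(Ω, ℂ)) r = (r : ℂ) • 1 := by
    intro r
    ext f t
    simp [smul_apply, Algebra.algebraMap_eq_smul_one]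
  ext f t
  simp only [map_add, map_sub, Polynomial.aeval_X, Polynomial.aeval_C, h, pow_two,
    LinearMap.add_apply, Module.End.mul_apply, LinearMap.sub_apply, LinearMap.smul_apply,
    Module.End.one_apply, add_apply, sub_apply, smul_apply, smul_eq_mul,
    map_mul, Complex.conj_ofReal, Complex.conj_I, LinearMap.map_smul]
  ring_nf
  simp only [Complex.I_sq]
  ring

/-- The integral identity behind the factorisation of a nonnegative polynomial. -/
theorem integral_conj_aeval_quadratic_mul (a b : ℝ) (r : Polynomial ℝ) (f : 𝓓(Ω, ℂ)) :
    ∫ t, conj (f t) * aeval (momentum Ω) (((X - C a) ^ 2 + C (b ^ 2)) * r) f t =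
      ∫ t, conj ((momentum Ω - (a + b * Complex.I : ℂ) • 1) f t) *
        aeval (momentum Ω) r ((momentum Ω - (a + b * Complex.I : ℂ) • 1) f) t := by
  rw [map_mul, aeval_momentum_quadratic, mul_assoc, Module.End.mul_apply,
    integral_conj_momentum_sub]
  -- `r(P)` must pass to the left of `P - z`, so that both sides of the pairing contain the same
  -- function `(P - z) f`.
  have h : Commute (momentum Ω - (a + b * Complex.I : ℂ) • 1) (aeval (momentum Ω) r) := by
    refine Commute.sub_left ?_ ((Commute.one_left _).smul_left _)
    have := Commute.all (X : Polynomial ℝ) r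
    simpa using this.map (aeval (momentum Ω))
  rw [h.eq]
  rfl

end Line

/-! ### Hardy and Rellich inequalities on the half-line. -/

/-- Hardy's inequality with power weights for the operators `-i d/dt - z`, `Im z ≥ 0`. -/
theorem weighted_hardy (a b : ℝ) (hb : 0 ≤ b) (k : ℕ) (f : 𝓓(posReals, ℂ)) :
    ((2 * k + 1) / 2 : ℝ) ^ 2 * ∫ t, ‖f t‖ ^ 2 / t ^ (2 * (k + 1)) ≤
      ∫ t, ‖(momentum posReals - (a + b * Complex.I : ℂ) • 1) f t‖ ^ 2 / t ^ (2 * k) := by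
  set κ : ℝ := (2 * k + 1) / 2 with hκ
  have hκ0 : 0 < κ := by positivity
  set g := (momentum posReals - (a + b * Complex.I : ℂ) • 1) f with hg
  -- The derivative of `‖f‖² / t^(2k+1)`. It integrates to zero, so any multiple of it may be added
  -- to the integrand; the multiple `κ` makes a square complete.
  let G' : ℝ → ℝ := fun t => 2 * inner ℝ (f t) (deriv f t) / t ^ (2 * k + 1) -
    (2 * k + 1) * ‖f t‖ ^ 2 / t ^ (2 * k + 2)
  have hderiv : ∀ t, HasDerivAt (fun t => ‖f t‖ ^ 2 / t ^ (2 * k + 1)) (G' t) t := by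
    intro t
    by_cases ht : t ∈ tsupport f
    · have ht0 : 0 < t := f.tsupport_subset ht
      have h1 := (hasDerivAt_test f t).norm_sq
      have h2 := hasDerivAt_pow (2 * k + 1) t
      refine (h1.div h2 (by positivity)).congr_deriv ?_
      simp only [G']
      push_cast
      field_simp
      ring
    · have h0 : f =ᶠ[nhds t] 0 := notMem_tsupport_iff_eventuallyEq.mp ht
      have e1 : G' t = 0 := by
        simp [G', h0.eq_of_nhds, h0.deriv_eq]
      rw [e1]
      refine (hasDerivAt_const t (0 : ℝ)).congr_of_eventuallyEq ?_
      filter_upwards [h0] with s hs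
      simp [hs]
  have hi1 : Integrable fun t => 2 * inner ℝ (f t) (deriv f t) / t ^ (2 * k + 1) := by
    have e1 : deriv f = dir ℂ (1 : ℝ) f := by ext t; rw [dir_one_apply]
    rw [e1]
    refine integrable_div_pow (φ := fun t => 2 * inner ℝ (f t) (dir ℂ (1 : ℝ) f t)) ?_ ?_ ?_ _
    · exact continuous_const.mul (f.continuous.inner (TestFunction.continuous _))
    · refine f.hasCompactSupport.mono fun t ht => ?_
      contrapose! ht
      simp [Function.notMem_support.mp ht]
    · refine (closure_mono fun t ht => ?_ : _ ⊆ tsupport f).trans f.tsupport_subset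
      contrapose! ht
      simp [Function.notMem_support.mp ht]
  have hi2 : Integrable fun t => (2 * k + 1) * ‖f t‖ ^ 2 / t ^ (2 * k + 2) := by
    simpa [mul_div_assoc] using (integrable_norm_sq_div_pow f (2 * k + 2)).const_mul (2 * k + 1 : ℝ)
  have hG' : Integrable G' := hi1.sub hi2
  have hzero : ∫ t, G' t = 0 :=
    integral_eq_zero_of_hasDerivAt_of_integrable hderiv hG' (integrable_norm_sq_div_pow f _)
  have hpt : ∀ t, κ * G' t + κ ^ 2 * (‖f t‖ ^ 2 / t ^ (2 * (k + 1))) ≤ ‖g t‖ ^ 2 / t ^ (2 * k) := by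
    intro t
    by_cases ht : t ∈ tsupport f
    swap
    · have h0 : f =ᶠ[nhds t] 0 := notMem_tsupport_iff_eventuallyEq.mp ht
      have : 0 ≤ ‖g t‖ ^ 2 / t ^ (2 * k) := by rw [pow_mul]; positivity
      simpa [G', h0.eq_of_nhds, h0.deriv_eq]
    have ht0 : 0 < t := f.tsupport_subset ht
    have hgt : g t = -Complex.I * deriv f t - (a + b * Complex.I) * f t := by
      simp [hg, LinearMap.sub_apply, sub_apply, smul_apply, momentum_apply]
    have key : 0 ≤ ‖g t‖ ^ 2 - 2 * κ / t * (inner ℝ (f t) (deriv f t) + b * ‖f t‖ ^ 2) +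
        κ ^ 2 / t ^ 2 * ‖f t‖ ^ 2 := by
      -- The real part `a` disappears from the cross term, because `‖f‖²` times a real number is
      -- multiplied by `i` there.
      have : ‖g t‖ ^ 2 - 2 * κ / t * (inner ℝ (f t) (deriv f t) + b * ‖f t‖ ^ 2) +
        κ ^ 2 / t ^ 2 * ‖f t‖ ^ 2 = ‖g t + (κ / t : ℝ) * Complex.I * f t‖ ^ 2 := by
        rw [hgt]
        simp only [Complex.sq_norm, Complex.normSq_apply, Complex.inner, Complex.mul_re,
          Complex.mul_im, Complex.conj_re, Complex.conj_im, Complex.add_re, Complex.add_im,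
          Complex.sub_re, Complex.sub_im, Complex.neg_re, Complex.neg_im, Complex.I_re,
          Complex.I_im, Complex.ofReal_re, Complex.ofReal_im]
        ring
      rw [this]; positivity
    have e : ‖g t‖ ^ 2 / t ^ (2 * k) - (κ * G' t + κ ^ 2 * (‖f t‖ ^ 2 / t ^ (2 * (k + 1)))) =
        (‖g t‖ ^ 2 - 2 * κ / t * (inner ℝ (f t) (deriv f t) + b * ‖f t‖ ^ 2) +
        κ ^ 2 / t ^ 2 * ‖f t‖ ^ 2) / t ^ (2 * k) + 2 * κ * b * ‖f t‖ ^ 2 / t ^ (2 * k + 1) := by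
      have : (2 * k + 1 : ℝ) = 2 * κ := by rw [hκ]; ring
      simp only [G', this]
      field_simp
      ring
    -- The only place where `Im z ≥ 0` is used: the leftover term has the sign of `b` and can be
    -- dropped.
    have : 0 ≤ 2 * κ * b * ‖f t‖ ^ 2 / t ^ (2 * k + 1) := by positivity
    have := div_nonneg key (pow_nonneg ht0.le (2 * k))
    linarith
  have := integral_mono ((hG'.const_mul κ).add
    ((integrable_norm_sq_div_pow f (2 * (k + 1))).const_mul (κ ^ 2)))
    (integrable_norm_sq_div_pow g (2 * k)) hpt
  rwa [integral_add' (hG'.const_mul κ)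
    ((integrable_norm_sq_div_pow f (2 * (k + 1))).const_mul (κ ^ 2)), integral_const_mul,
    integral_const_mul, hzero, mul_zero, zero_add] at this

theorem rellichConst_zero : rellichConst 0 = 1 := by simp [rellichConst]

theorem rellichConst_succ (m : ℕ) :
    rellichConst (m + 1) = rellichConst m * ((2 * m + 1) / 2 : ℝ) ^ 2 := by
  have : (Nat.doubleFactorial (2 * (m + 1) - 1) : ℝ) =
      (2 * m + 1) * Nat.doubleFactorial (2 * m - 1) := by
    cases m with
    | zero => simp
    | succ k =>
      rw [show 2 * (k + 1 + 1) - 1 = (2 * k + 1) + 2 by omega, Nat.doubleFactorial_add_two,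
        show 2 * (k + 1) - 1 = 2 * k + 1 by omega]
      push_cast; ring
  rw [rellichConst, rellichConst, this]
  field_simp
  ring

theorem rellichConst_pos (m : ℕ) : 0 < rellichConst m := by
  have := Nat.doubleFactorial_pos (2 * m - 1)
  unfold rellichConst
  positivity

/-- A nonnegative real polynomial splits off a nonnegative quadratic factor. -/
theorem exists_quadratic_factor {m : ℕ} {p : Polynomial ℝ} (hp : p.Monic)
    (hd : p.natDegree = 2 * (m + 1)) (h0 : ∀ t, 0 ≤ p.eval t) :
    ∃ (a b : ℝ) (r : Polynomial ℝ), 0 ≤ b ∧ p = ((X - C a) ^ 2 + C (b ^ 2)) * r ∧ r.Monic ∧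
      r.natDegree = 2 * m ∧ ∀ t, 0 ≤ r.eval t := by
  have hfac : ∃ (a b : ℝ) (r : Polynomial ℝ), 0 ≤ b ∧ p = ((X - C a) ^ 2 + C (b ^ 2)) * r := by
    obtain ⟨z, hz⟩ := Complex.exists_root (f := p.map (algebraMap ℝ ℂ)) (by
      rw [Polynomial.degree_map, Polynomial.degree_eq_natDegree hp.ne_zero, hd]
      norm_cast; omega)
    have hz' : aeval z p = 0 := by
      rwa [Polynomial.IsRoot.def, Polynomial.eval_map_algebraMap] at hz
    by_cases him : z.im = 0
    · have hzr : z = (z.re : ℂ) := Complex.ext rfl (by simp [him])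
      have hroot : p.eval z.re = 0 := by
        rw [hzr] at hz'
        have := Polynomial.aeval_algebraMap_apply ℂ z.re p
        simp only [Complex.coe_algebraMap] at this
        rw [this] at hz'
        simpa using hz'
      obtain ⟨s, hs⟩ := Polynomial.dvd_iff_isRoot.mpr hroot
      -- A real root of a nonnegative polynomial is a minimum, so the derivative vanishes there too
      -- and the root is at least double; this is the case `b = 0`.
      have hmin : IsLocalMin (fun t => p.eval t) z.re :=
        Filter.Eventually.of_forall fun t => by simpa [hroot] using h0 t
      have hder := hmin.deriv_eq_zero
      rw [Polynomial.deriv, hs] at hder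
      have hsr : s.IsRoot z.re := by simpa [Polynomial.derivative_mul] using hder
      obtain ⟨r, hr⟩ := Polynomial.dvd_iff_isRoot.mpr hsr
      exact ⟨z.re, 0, r, le_rfl, by rw [hs, hr]; simp; ring⟩
    · obtain ⟨r, hr⟩ := Polynomial.quadratic_dvd_of_aeval_eq_zero_im_ne_zero p hz' him
      -- A nonreal root comes with its conjugate, so the one in the upper half-plane may be chosen.
      refine ⟨z.re, |z.im|, r, abs_nonneg _, ?_⟩
      rw [hr, sq_abs, Complex.sq_norm, Complex.normSq_apply]
      simp only [map_add, map_mul, map_pow, Polynomial.C_ofNat]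
      ring
  obtain ⟨a, b, r, hb, rfl⟩ := hfac
  have hq : ((X - C a) ^ 2 + C (b ^ 2) : Polynomial ℝ).Monic := by
    refine ((Polynomial.monic_X_sub_C a).pow 2).add_of_left ?_
    rw [Polynomial.degree_pow, Polynomial.degree_X_sub_C]
    exact Polynomial.degree_C_le.trans_lt (by norm_num)
  have hqd : ((X - C a) ^ 2 + C (b ^ 2) : Polynomial ℝ).natDegree = 2 := by
    compute_degree!
  have hr : r.Monic := hq.of_mul_monic_left hp
  refine ⟨a, b, r, hb, rfl, hr, ?_, ?_⟩
  · rw [hq.natDegree_mul hr, hqd] at hd; omega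
  · have hc : IsClosed {t | 0 ≤ r.eval t} := isClosed_le continuous_const r.continuous
    -- Away from `a` the quadratic factor is strictly positive; when `b = 0` the point `a` itself is
    -- reached by density.
    have hsub : ({a}ᶜ : Set ℝ) ⊆ {t | 0 ≤ r.eval t} := by
      intro t ht
      have h1 := h0 t
      have h2 : 0 < (t - a) ^ 2 + b ^ 2 := by
        have := sq_pos_of_ne_zero (sub_ne_zero.mpr ht)
        positivity
      simp only [Polynomial.eval_mul, Polynomial.eval_add, Polynomial.eval_pow,
        Polynomial.eval_sub, Polynomial.eval_X, Polynomial.eval_C] at h1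
      exact nonneg_of_mul_nonneg_right h1 h2
    intro t
    have := (dense_compl_singleton a).closure_eq ▸ closure_minimal hsub hc
    exact this (mem_univ t)

/-- The one-dimensional Rellich inequality for a nonnegative polynomial of `-i d/dt`. -/
theorem rellich_line (m : ℕ) : ∀ (p : Polynomial ℝ), p.Monic → p.natDegree = 2 * m →
    (∀ t, 0 ≤ p.eval t) → ∀ f : 𝓓(posReals, ℂ),
    rellichConst m * ∫ t, ‖f t‖ ^ 2 / t ^ (2 * m) ≤
      (∫ t, conj (f t) * aeval (momentum posReals) p f t).re := by
  induction m with
  | zero =>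
    intro p hp hd _ f
    have : p = 1 := hp.natDegree_eq_zero.mp (by simpa using hd)
    simp only [this, rellichConst_zero, one_mul, mul_zero, pow_zero, div_one, map_one,
      Module.End.one_apply, Complex.conj_mul', ← Complex.ofReal_pow, integral_complex_ofReal,
      Complex.ofReal_re, le_refl]
  | succ m ih =>
    intro p hp hd h0 f
    obtain ⟨a, b, r, hb, rfl, hr, hrd, hr0⟩ := exists_quadratic_factor hp hd h0
    rw [integral_conj_aeval_quadratic_mul, rellichConst_succ, mul_assoc]
    -- The induction hypothesis applies to the test function `(P - z) f` with weight `t^(-2m)`;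
    -- Hardy's inequality with `k = m` then recovers `f`.
    refine le_trans ?_ (ih r hr hrd hr0 _)
    exact mul_le_mul_of_nonneg_left (weighted_hardy a b hb m f) (rellichConst_pos m).le

/-! ### The half-space as a product, and the tangential Fourier transform. -/

section

variable {n : ℕ} {ν : EuclideanSpace ℝ (Fin n)}

/-- The boundary hyperplane of the half-space, as a linear subspace. -/
abbrev hyperplane (ν : EuclideanSpace ℝ (Fin n)) : Submodule ℝ (EuclideanSpace ℝ (Fin n)) :=
  (Submodule.span ℝ {ν})ᗮ

theorem inner_hyperplane (x : hyperplane ν) : inner ℝ ν (x : EuclideanSpace ℝ (Fin n)) = 0 :=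
  Submodule.mem_orthogonal_singleton_iff_inner_right.mp x.2

theorem inner_join (hν : ‖ν‖ = 1) (x : hyperplane ν) (t : ℝ) :
    inner ℝ ν ((x : EuclideanSpace ℝ (Fin n)) + t • ν) = t := by
  simp [inner_add_right, inner_hyperplane, inner_smul_right, hν]

theorem norm_le_norm_join (x : hyperplane ν) (t : ℝ) :
    ‖x‖ ≤ ‖(x : EuclideanSpace ℝ (Fin n)) + t • ν‖ := by
  have : ‖(x : EuclideanSpace ℝ (Fin n)) + t • ν‖ ^ 2 = ‖x‖ ^ 2 + ‖t • ν‖ ^ 2 := by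
    rw [norm_add_sq_real, inner_smul_right, real_inner_comm, inner_hyperplane]; simp
  refine le_of_sq_le_sq ?_ (norm_nonneg _)
  rw [this]
  nlinarith [sq_nonneg ‖t • ν‖]

theorem continuous_join :
    Continuous fun p : hyperplane ν × ℝ => (p.1 : EuclideanSpace ℝ (Fin n)) + p.2 • ν := by
  fun_prop

/-- The map is a composition of isometries and of the volume-preserving passage to the `L²` product,
through the orthogonal decomposition along `ν`. Hence no Jacobian enters Fubini's theorem. -/
theorem measurePreserving_join (hν : ‖ν‖ = 1) :
    MeasurePreserving (fun p : hyperplane ν × ℝ => (p.1 : EuclideanSpace ℝ (Fin n)) + p.2 • ν)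
      (volume.prod volume) volume := by
  let K := Submodule.span ℝ {ν}
  have h1 : MeasurePreserving (Prod.swap : hyperplane ν × ℝ → ℝ × hyperplane ν)
      (volume.prod volume) (volume.prod volume) := Measure.measurePreserving_swap
  have h2 : MeasurePreserving (Prod.map (LinearIsometryEquiv.toSpanUnitSingleton (𝕜 := ℝ) ν hν) id :
      ℝ × hyperplane ν → K × hyperplane ν) (volume.prod volume) (volume.prod volume) :=
    (LinearIsometryEquiv.toSpanUnitSingleton (𝕜 := ℝ) ν hν).measurePreserving.prod
      (MeasurePreserving.id _)
  have h3 : MeasurePreserving (WithLp.toLp 2 : K × Kᗮ → _) volume volume :=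
    WithLp.volume_preserving_toLp K Kᗮ
  have h4 := K.orthogonalDecomposition.symm.measurePreserving
  have e : (fun p : hyperplane ν × ℝ => (p.1 : EuclideanSpace ℝ (Fin n)) + p.2 • ν) =
      K.orthogonalDecomposition.symm ∘ WithLp.toLp 2 ∘
        Prod.map (LinearIsometryEquiv.toSpanUnitSingleton (𝕜 := ℝ) ν hν) id ∘ Prod.swap := by
    funext p
    simp [K, add_comm]
  rw [e]
  exact h4.comp (h3.comp (h2.comp h1))

theorem integral_join (hν : ‖ν‖ = 1) {F : Type*} [NormedAddCommGroup F] [NormedSpace ℝ F]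
    {f : EuclideanSpace ℝ (Fin n) → F} (hf : Continuous f) :
    ∫ x, f x = ∫ p : hyperplane ν × ℝ, f (p.1 + p.2 • ν) := by
  have h := measurePreserving_join hν
  conv_lhs => rw [← h.map_eq]
  rw [integral_map h.aemeasurable (hf.aestronglyMeasurable)]
  rfl

theorem integrable_join (hν : ‖ν‖ = 1) {F : Type*} [NormedAddCommGroup F] [NormedSpace ℝ F]
    {f : EuclideanSpace ℝ (Fin n) → F} (hf : Integrable f) :
    Integrable (fun p : hyperplane ν × ℝ => f (p.1 + p.2 • ν)) (volume.prod volume) :=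
  (measurePreserving_join hν).integrable_comp_of_integrable hf

/-- The restriction of a test function to the hyperplane `{ν ⬝ x = t}`. -/
def slice (f : 𝓓(halfSpace ν, ℝ)) (t : ℝ) : SchwartzMap (hyperplane ν) ℂ :=
  HasCompactSupport.toSchwartzMap
    (f := fun x : hyperplane ν => ((f ((x : EuclideanSpace ℝ (Fin n)) + t • ν) : ℝ) : ℂ))
    (by
      have h1 : Topology.IsClosedEmbedding
          (fun x : hyperplane ν => (x : EuclideanSpace ℝ (Fin n)) + t • ν) :=
        (Homeomorph.addRight (t • ν)).isClosedEmbedding.comp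
          (hyperplane ν).subtypeₗᵢ.isometry.isClosedEmbedding
      exact (f.hasCompactSupport.comp_isClosedEmbedding h1).comp_left (g := Complex.ofReal) rfl)
    (by
      have := f.contDiff
      refine Complex.ofRealCLM.contDiff.comp (f.contDiff.comp ?_)
      exact (hyperplane ν).subtypeL.contDiff.add contDiff_const)

theorem slice_apply (f : 𝓓(halfSpace ν, ℝ)) (t : ℝ) (x : hyperplane ν) :
    slice f t x = (f ((x : EuclideanSpace ℝ (Fin n)) + t • ν) : ℂ) := rfl

/-- The Fourier transform in the directions parallel to the boundary. -/
def partialFourierFun (ξ : hyperplane ν) (f : 𝓓(halfSpace ν, ℝ)) (t : ℝ) : ℂ :=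
  𝓕 (slice f t) ξ

theorem partialFourierFun_eq (ξ : hyperplane ν) (f : 𝓓(halfSpace ν, ℝ)) (t : ℝ) :
    partialFourierFun ξ f t = ∫ x : hyperplane ν, (Real.fourierChar (-inner ℝ x ξ) : ℂ) *
      (f ((x : EuclideanSpace ℝ (Fin n)) + t • ν) : ℂ) := by
  rw [partialFourierFun, SchwartzMap.fourier_coe, Real.fourier_eq]
  rfl

theorem integrable_fourierChar_mul_slice (ξ : hyperplane ν) (f : 𝓓(halfSpace ν, ℝ)) (t : ℝ) :
    Integrable fun x : hyperplane ν => (Real.fourierChar (-inner ℝ x ξ) : ℂ) *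
      (f ((x : EuclideanSpace ℝ (Fin n)) + t • ν) : ℂ) := by
  refine ((slice f t).integrable (μ := volume)).bdd_mul (c := 1) ?_ ?_
  · exact (by fun_prop : Continuous fun x : hyperplane ν =>
      (Real.fourierChar (-inner ℝ x ξ) : ℂ)).aestronglyMeasurable
  · exact Filter.Eventually.of_forall fun x => (Circle.norm_coe _).le

theorem hasDerivAt_test_join (f : 𝓓(halfSpace ν, ℝ)) (x : EuclideanSpace ℝ (Fin n)) (t : ℝ) :
    HasDerivAt (fun t : ℝ => f (x + t • ν)) (dir ℝ ν f (x + t • ν)) t := by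
  rw [dir_eq_fderiv]
  have h1 := (differentiable_test f (x + t • ν)).hasFDerivAt
  have h2 : HasDerivAt (fun t : ℝ => x + t • ν) ν t := by
    simpa using ((hasDerivAt_id t).smul_const ν).const_add x
  exact h1.comp_hasDerivAt t h2

theorem hasDerivAt_partialFourierFun (ξ : hyperplane ν) (f : 𝓓(halfSpace ν, ℝ)) (t : ℝ) :
    HasDerivAt (partialFourierFun ξ f) (partialFourierFun ξ (dir ℝ ν f) t) t := by
  obtain ⟨R, hR⟩ := (dir ℝ ν f).hasCompactSupport.isBounded.exists_norm_le
  obtain ⟨c, hc⟩ := (dir ℝ ν f).continuous.bounded_above_of_compact_support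
    (dir ℝ ν f).hasCompactSupport
  have e : partialFourierFun ξ f = fun t => ∫ x : hyperplane ν,
      (Real.fourierChar (-inner ℝ x ξ) : ℂ) *
      (f ((x : EuclideanSpace ℝ (Fin n)) + t • ν) : ℂ) := funext (partialFourierFun_eq ξ f)
  rw [e, partialFourierFun_eq]
  -- Since `‖x‖ ≤ ‖x + tν‖`, all slices are supported in one ball of radius `R`, which gives a
  -- dominating function independent of `t`.
  refine (hasDerivAt_integral_of_dominated_loc_of_deriv_le (s := univ)
    (bound := (Metric.closedBall (0 : hyperplane ν) R).indicator fun _ => c) Filter.univ_mem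
    (Filter.Eventually.of_forall fun t =>
      (integrable_fourierChar_mul_slice ξ f t).aestronglyMeasurable)
    (integrable_fourierChar_mul_slice ξ f t)
    (F' := fun t x => (Real.fourierChar (-inner ℝ x ξ) : ℂ) *
      (dir ℝ ν f ((x : EuclideanSpace ℝ (Fin n)) + t • ν) : ℂ))
    (integrable_fourierChar_mul_slice ξ _ t).aestronglyMeasurable
    (Filter.Eventually.of_forall fun x s _ => ?_) ?_
    (Filter.Eventually.of_forall fun x s _ => ?_)).2
  · rw [norm_mul, Circle.norm_coe, one_mul, Complex.norm_real]
    by_cases hx : x ∈ Metric.closedBall (0 : hyperplane ν) R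
    · rw [indicator_of_mem hx]; exact hc _
    · rw [indicator_of_notMem hx]
      have : dir ℝ ν f ((x : EuclideanSpace ℝ (Fin n)) + s • ν) = 0 := by
        by_contra h
        have := hR _ (subset_tsupport _ h)
        exact hx (by simpa using (norm_le_norm_join x s).trans this)
      simp [this]
  · exact (integrable_indicator_iff measurableSet_closedBall).mpr
      (integrableOn_const (isCompact_closedBall _ _).measure_ne_top)
  · exact ((hasDerivAt_test_join f x s).ofReal_comp).const_mul _

theorem contDiff_partialFourierFun (ξ : hyperplane ν) (f : 𝓓(halfSpace ν, ℝ)) :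
    ContDiff ℝ ∞ (partialFourierFun ξ f) := by
  refine contDiff_infty.mpr fun k => ?_
  induction k generalizing f with
  | zero =>
    exact contDiff_zero.mpr (continuous_iff_continuousAt.mpr fun t =>
      (hasDerivAt_partialFourierFun ξ f t).continuousAt)
  | succ k ih =>
    push_cast
    rw [contDiff_succ_iff_deriv]
    refine ⟨fun t => (hasDerivAt_partialFourierFun ξ f t).differentiableAt, by simp, ?_⟩
    have : deriv (partialFourierFun ξ f) = partialFourierFun ξ (dir ℝ ν f) :=
      funext fun t => (hasDerivAt_partialFourierFun ξ f t).deriv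
    rw [this]; exact ih _

theorem support_partialFourierFun (hν : ‖ν‖ = 1) (ξ : hyperplane ν) (f : 𝓓(halfSpace ν, ℝ)) :
    Function.support (partialFourierFun ξ f) ⊆ (fun x => inner ℝ ν x) '' tsupport f := by
  intro t ht
  by_contra h
  refine ht ?_
  rw [partialFourierFun_eq]
  have : ∀ x : hyperplane ν, f ((x : EuclideanSpace ℝ (Fin n)) + t • ν) = 0 := by
    intro x
    by_contra hx
    exact h ⟨_, subset_tsupport _ hx, inner_join hν x t⟩
  simp [this]

/-- The partial Fourier transform at frequency `ξ`, as a test function of the normal variable. -/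
def partialFourier (hν : ‖ν‖ = 1) (ξ : hyperplane ν) :
    𝓓(halfSpace ν, ℝ) →ₗ[ℝ] 𝓓(posReals, ℂ) where
  toFun f :=
    { toFun := partialFourierFun ξ f
      contDiff' := contDiff_partialFourierFun ξ f
      hasCompactSupport' := HasCompactSupport.of_support_subset_isCompact
        (f.hasCompactSupport.image (by fun_prop)) (support_partialFourierFun hν ξ f)
      tsupport_subset' := by
        refine (closure_minimal (support_partialFourierFun hν ξ f)
          (f.hasCompactSupport.image (by fun_prop)).isClosed).trans ?_
        rintro _ ⟨x, hx, rfl⟩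
        exact f.tsupport_subset hx }
  map_add' f g := by
    ext t
    change partialFourierFun ξ (f + g) t = partialFourierFun ξ f t + partialFourierFun ξ g t
    simp only [partialFourierFun_eq]
    rw [← integral_add (integrable_fourierChar_mul_slice ξ f t)
      (integrable_fourierChar_mul_slice ξ g t)]
    simp [add_apply, mul_add]
  map_smul' c f := by
    ext t
    change partialFourierFun ξ (c • f) t = c • partialFourierFun ξ f t
    simp only [partialFourierFun_eq]
    rw [← integral_smul]
    congr 1
    ext x
    simp [smul_apply, mul_left_comm]

variable (hν : ‖ν‖ = 1)

theorem partialFourier_apply (ξ : hyperplane ν) (f : 𝓓(halfSpace ν, ℝ)) (t : ℝ) :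
    partialFourier hν ξ f t = 𝓕 (slice f t) ξ := rfl

theorem partialFourier_dir_normal (ξ : hyperplane ν) (f : 𝓓(halfSpace ν, ℝ)) :
    partialFourier hν ξ (dir ℝ ν f) = dir ℂ (1 : ℝ) (partialFourier hν ξ f) := by
  ext t
  rw [dir_one_apply]
  exact (hasDerivAt_partialFourierFun ξ f t).deriv.symm

theorem slice_dir (v : hyperplane ν) (f : 𝓓(halfSpace ν, ℝ)) (t : ℝ) :
    slice (dir ℝ (v : EuclideanSpace ℝ (Fin n)) f) t = LineDeriv.lineDerivOp v (slice f t) := by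
  ext x
  rw [SchwartzMap.lineDerivOp_apply_eq_fderiv, slice_apply, dir_eq_fderiv]
  have h1 : HasFDerivAt (fun x : hyperplane ν => (x : EuclideanSpace ℝ (Fin n)) + t • ν)
      (hyperplane ν).subtypeL x := (hyperplane ν).subtypeL.hasFDerivAt.add_const _
  have h2 := (differentiable_test f ((x : EuclideanSpace ℝ (Fin n)) + t • ν)).hasFDerivAt
  have h3 : HasFDerivAt (slice f t) _ x :=
    Complex.ofRealCLM.hasFDerivAt.comp x (h2.comp x h1)
  rw [h3.fderiv]
  simp

theorem partialFourier_dir_tangent (ξ v : hyperplane ν) (f : 𝓓(halfSpace ν, ℝ)) :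
    partialFourier hν ξ (dir ℝ (v : EuclideanSpace ℝ (Fin n)) f) =
      (2 * Real.pi * Complex.I * (inner ℝ ξ v : ℝ) : ℂ) • partialFourier hν ξ f := by
  ext t
  rw [partialFourier_apply, slice_dir, SchwartzMap.fourier_lineDerivOp_eq, smul_apply, smul_apply,
    SchwartzMap.smulLeftCLM_apply_apply (by fun_prop), partialFourier_apply]
  simp only [smul_eq_mul, Complex.real_smul]
  ring

/-- The real polynomial `⟨2πξ + Xν, v⟩`. -/
def linePoly (ξ : hyperplane ν) (v : EuclideanSpace ℝ (Fin n)) : Polynomial ℝ :=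
  C (2 * Real.pi * inner ℝ (ξ : EuclideanSpace ℝ (Fin n)) v) + C (inner ℝ ν v) * X

/-- Split `v` into normal and tangential parts: the former gives `d/dt = iP`, the latter
multiplication by `2πi⟨ξ, v⟩`. Together they are `i` times the real polynomial `linePoly ξ v` at
`P`. -/
theorem partialFourier_dir (ξ : hyperplane ν) (v : EuclideanSpace ℝ (Fin n))
    (f : 𝓓(halfSpace ν, ℝ)) :
    partialFourier hν ξ (dir ℝ v f) =
      aeval (momentum posReals) (C Complex.I * (linePoly ξ v).map (algebraMap ℝ ℂ))
        (partialFourier hν ξ f) := by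
  obtain ⟨w, hw⟩ : ∃ w : hyperplane ν, (w : EuclideanSpace ℝ (Fin n)) = v - inner ℝ ν v • ν :=
    ⟨⟨v - inner ℝ ν v • ν, Submodule.mem_orthogonal_singleton_iff_inner_right.mpr (by
      simp [inner_sub_right, inner_smul_right, hν])⟩, rfl⟩
  have hv : v = inner ℝ ν v • ν + w := by rw [hw]; abel
  have hin : inner ℝ ξ w = inner ℝ (ξ : EuclideanSpace ℝ (Fin n)) v := by
    rw [Submodule.coe_inner, hw, inner_sub_right, inner_smul_right, real_inner_comm ν,
      inner_hyperplane]
    simp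
  conv_lhs => rw [hv, dir_add_smul]
  rw [LinearMap.add_apply, LinearMap.smul_apply, map_add, map_smul, partialFourier_dir_normal,
    partialFourier_dir_tangent, hin]
  ext t
  simp only [linePoly, Polynomial.map_add, Polynomial.map_mul, Polynomial.map_C, Polynomial.map_X,
    map_add, map_mul, Polynomial.aeval_C, Polynomial.aeval_X, Module.End.mul_apply,
    LinearMap.add_apply, Algebra.algebraMap_eq_smul_one, LinearMap.smul_apply,
    Module.End.one_apply, add_apply, smul_apply, momentum, smul_eq_mul, Complex.real_smul,
    mul_one, Complex.ofReal_ofNat]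
  linear_combination ((inner ℝ ν v : ℝ) * (dir ℂ (1 : ℝ) (partialFourier hν ξ f) t) : ℂ) *
    Complex.I_sq

end

/-! ### Plancherel and the inequality with the Euclidean distance. -/

section

variable {n : ℕ} {ν : EuclideanSpace ℝ (Fin n)} (hν : ‖ν‖ = 1)

theorem stronglyMeasurable_partialFourier (f : 𝓓(halfSpace ν, ℝ)) :
    StronglyMeasurable fun p : hyperplane ν × ℝ => partialFourier hν p.1 f p.2 := by
  have e : (fun p : hyperplane ν × ℝ => partialFourier hν p.1 f p.2) = fun p =>
      ∫ x : hyperplane ν, (fun q : (hyperplane ν × ℝ) × hyperplane ν =>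
        (Real.fourierChar (-inner ℝ q.2 q.1.1) : ℂ) *
        (f ((q.2 : EuclideanSpace ℝ (Fin n)) + q.1.2 • ν) : ℂ)) (p, x) :=
    funext fun p => partialFourierFun_eq p.1 f p.2
  rw [e]
  have hc : Continuous fun q : (hyperplane ν × ℝ) × hyperplane ν =>
        (Real.fourierChar (-inner ℝ q.2 q.1.1) : ℂ) *
        (f ((q.2 : EuclideanSpace ℝ (Fin n)) + q.1.2 • ν) : ℂ) := by fun_prop
  exact hc.stronglyMeasurable.integral_prod_right'

/-- Plancherel on each slice reduces the double integral to that of `f²`. Joint square integrability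
is what justifies exchanging `ξ` and `t` below. -/
theorem memLp_partialFourier (f : 𝓓(halfSpace ν, ℝ)) :
    MemLp (fun p : hyperplane ν × ℝ => partialFourier hν p.1 f p.2) 2 (volume.prod volume) := by
  have hm := stronglyMeasurable_partialFourier hν f
  rw [memLp_two_iff_integrable_sq_norm hm.aestronglyMeasurable,
    integrable_prod_iff' (f := fun p : hyperplane ν × ℝ => ‖partialFourier hν p.1 f p.2‖ ^ 2)
      (hm.norm.pow 2).aestronglyMeasurable]
  constructor
  · refine Filter.Eventually.of_forall fun t => ?_
    exact (memLp_two_iff_integrable_sq_norm (𝓕 (slice f t)).continuous.aestronglyMeasurable).mp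
      ((𝓕 (slice f t)).memLp 2 volume)
  · have h1 := (integrable_join hν (integrable_mul_test f f)).integral_prod_right
    refine h1.congr (Filter.Eventually.of_forall fun t => ?_)
    have := SchwartzMap.integral_norm_sq_fourier (slice f t)
    simp only [partialFourier_apply, norm_pow, norm_norm]
    rw [this]
    simp [slice_apply, pow_two]

theorem integrable_partialFourier (f g : 𝓓(halfSpace ν, ℝ)) :
    Integrable (fun p : hyperplane ν × ℝ => conj (partialFourier hν p.1 f p.2) *
      partialFourier hν p.1 g p.2) (volume.prod volume) :=
  (memLp_partialFourier hν f).star.integrable_mul (memLp_partialFourier hν g)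

/-- Plancherel's identity for the partial Fourier transform. -/
theorem plancherel (f g : 𝓓(halfSpace ν, ℝ)) :
    ((∫ x, f x * g x : ℝ) : ℂ) = ∫ ξ : hyperplane ν, ∫ t, conj (partialFourier hν ξ f t) *
      partialFourier hν ξ g t := by
  rw [integral_integral_swap (integrable_partialFourier hν f g),
    integral_join hν (f := fun x => f x * g x) (f.continuous.mul g.continuous),
    Measure.volume_eq_prod, integral_prod_symm _ (integrable_join hν (integrable_mul_test f g)),
    ← integral_complex_ofReal]
  congr 1
  ext t
  have := SchwartzMap.integral_inner_fourier_fourier (slice f t) (slice g t)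
  simp only [RCLike.inner_apply', slice_apply, Complex.conj_ofReal] at this
  simp only [partialFourier_apply, this, ← integral_complex_ofReal, Complex.ofReal_mul]

/-- The symbol along the line `2πξ + ℝν`, as a polynomial. -/
def symbolPoly (m : ℕ) (a : (Fin n → ℕ) → ℝ) (ξ : hyperplane ν) : Polynomial ℝ :=
  (-1) ^ m * opIn m a (fun i => linePoly ξ (EuclideanSpace.single i 1))

theorem eval_symbolPoly (m : ℕ) (a : (Fin n → ℕ) → ℝ) (ξ : hyperplane ν) (t : ℝ) :
    (symbolPoly m a ξ).eval t =
      symbol m a ((2 * Real.pi) • (ξ : EuclideanSpace ℝ (Fin n)) + t • ν) := by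
  have h := map_opIn (aeval t : Polynomial ℝ →ₐ[ℝ] ℝ) m a
    (fun i => linePoly ξ (EuclideanSpace.single i 1))
  have e : (fun i => aeval t (linePoly ξ (EuclideanSpace.single i (1 : ℝ)))) =
      fun i => ((2 * Real.pi) • (ξ : EuclideanSpace ℝ (Fin n)) + t • ν) i := by
    funext i
    simp only [linePoly, EuclideanSpace.inner_single_right, map_add, map_mul, Polynomial.aeval_C,
      Polynomial.aeval_X, Algebra.algebraMap_self, RingHom.id_apply, conj_trivial, one_mul,
      PiLp.add_apply, PiLp.smul_apply, smul_eq_mul]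
    ring
  rw [e, opIn_real, Polynomial.coe_aeval_eq_eval] at h
  rw [symbolPoly, Polynomial.eval_mul, h]
  simp [← mul_assoc, ← mul_pow]

/-- The top coefficient does not depend on `ξ`, so one normalisation by `H(ν)` makes the polynomials
of all frequencies monic. -/
theorem natDegree_coeff_symbolPoly (m : ℕ) (a : (Fin n → ℕ) → ℝ) (ξ : hyperplane ν) :
    (symbolPoly m a ξ).natDegree ≤ 2 * m ∧ (symbolPoly m a ξ).coeff (2 * m) = symbol m a ν := by
  have h1 : ∀ i : Fin n, (linePoly ξ (EuclideanSpace.single i (1 : ℝ))).natDegree ≤ 1 ∧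
      (linePoly ξ (EuclideanSpace.single i (1 : ℝ))).coeff 1 = ν i := by
    intro i
    constructor
    · unfold linePoly; compute_degree
    · simp [linePoly, EuclideanSpace.inner_single_right, Polynomial.coeff_C]
  have h2 : ∀ (α : Fin n → ℕ) (i : Fin n),
      (linePoly ξ (EuclideanSpace.single i (1 : ℝ)) ^ α i).natDegree ≤ α i ∧
      (linePoly ξ (EuclideanSpace.single i (1 : ℝ)) ^ α i).coeff (α i) = ν i ^ α i := by
    intro α i
    refine ⟨by simpa using Polynomial.natDegree_pow_le_of_le (α i) (h1 i).1, ?_⟩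
    have := Polynomial.coeff_pow_of_natDegree_le (m := α i) (h1 i).1
    rw [mul_one, (h1 i).2] at this
    exact this
  have h3 : ∀ (α : Fin n → ℕ) (s : Finset (Fin n)),
      (∏ i ∈ s, linePoly ξ (EuclideanSpace.single i (1 : ℝ)) ^ α i).natDegree ≤ ∑ i ∈ s, α i ∧
      (∏ i ∈ s, linePoly ξ (EuclideanSpace.single i (1 : ℝ)) ^ α i).coeff (∑ i ∈ s, α i) =
        ∏ i ∈ s, ν i ^ α i := by
    intro α s
    induction s using Finset.cons_induction with
    | empty => simp
    | cons i s hi ih =>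
      simp only [Finset.prod_cons, Finset.sum_cons]
      refine ⟨Polynomial.natDegree_mul_le_of_le (h2 α i).1 ih.1, ?_⟩
      rw [Polynomial.coeff_mul_add_eq_of_natDegree_le (h2 α i).1 ih.1, (h2 α i).2, ih.2]
  have e : symbolPoly m a ξ = ∑ α ∈ multiIndices n m,
      a α • ∏ i, linePoly ξ (EuclideanSpace.single i (1 : ℝ)) ^ α i := by
    rw [symbolPoly, opIn_comm, ← mul_assoc, ← mul_pow]; simp
  have hsum : ∀ α ∈ multiIndices n m, ∑ i, α i = 2 * m := fun α hα => by
    simpa [multiIndices] using hα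
  rw [e]
  constructor
  · refine Polynomial.natDegree_sum_le_of_forall_le _ _ fun α hα => ?_
    refine (Polynomial.natDegree_smul_le _ _).trans ?_
    rw [← hsum α hα]
    exact (h3 α Finset.univ).1
  · rw [Polynomial.finsetSum_coeff, symbol]
    refine Finset.sum_congr rfl fun α hα => ?_
    rw [Polynomial.coeff_smul, ← hsum α hα, (h3 α Finset.univ).2, smul_eq_mul]

theorem partialFourier_operator (m : ℕ) (a : (Fin n → ℕ) → ℝ) (ξ : hyperplane ν)
    (f : 𝓓(halfSpace ν, ℝ)) :
    partialFourier hν ξ (opIn m a (fun i => dir ℝ (EuclideanSpace.single i 1)) f) =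
      aeval (momentum posReals) (symbolPoly m a ξ) (partialFourier hν ξ f) := by
  rw [intertwine_opIn (partialFourier hν ξ) m a _ _
    (fun i f => partialFourier_dir hν ξ (EuclideanSpace.single i 1) f)]
  congr 1
  have h1 := map_opIn ((aeval (R := ℂ) (momentum posReals)).restrictScalars ℝ) m a
    (fun i => C Complex.I * (linePoly ξ (EuclideanSpace.single i 1)).map (algebraMap ℝ ℂ))
  have h2 := map_opIn (Polynomial.mapAlgHom (Algebra.ofId ℝ ℂ)) m a
    (fun i => linePoly ξ (EuclideanSpace.single i 1))
  simp only [AlgHom.restrictScalars_apply] at h1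
  rw [← h1, opIn_smul]
  simp only [Polynomial.coe_mapAlgHom] at h2
  have e : ((Algebra.ofId ℝ ℂ : ℝ →ₐ[ℝ] ℂ) : ℝ →+* ℂ) = algebraMap ℝ ℂ := rfl
  rw [e] at h2
  rw [← h2, symbolPoly, ← Polynomial.aeval_map_algebraMap (R := ℝ) ℂ, Polynomial.map_mul]
  congr 2
  -- The factor `i^(2m)` extracted by homogeneity is the sign `(-1)^m` built into `symbolPoly`.
  rw [pow_mul, ← map_pow, Complex.I_sq]
  simp

theorem contDiff_mul_of_tsupport {E : Type*} [NormedAddCommGroup E] [NormedSpace ℝ E] {f g : E → ℝ}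
    {U : Set E} (hU : IsOpen U) (hf : ContDiff ℝ ∞ f) (hs : tsupport f ⊆ U)
    (hg : ContDiffOn ℝ ∞ g U) : ContDiff ℝ ∞ fun x => f x * g x := by
  refine contDiff_iff_contDiffAt.mpr fun x => ?_
  by_cases hx : x ∈ tsupport f
  · exact hf.contDiffAt.mul (hg.contDiffAt (hU.mem_nhds (hs hx)))
  · have h0 : f =ᶠ[nhds x] 0 := notMem_tsupport_iff_eventuallyEq.mp hx
    refine (contDiffAt_const (c := (0 : ℝ))).congr_of_eventuallyEq ?_
    filter_upwards [h0] with y hy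
    simp [hy]

/-- The test function `f g`, where `g` is smooth on `Ω`. -/
def mulTest {E : Type*} [NormedAddCommGroup E] [NormedSpace ℝ E] {Ω : TopologicalSpace.Opens E}
    (f : 𝓓(Ω, ℝ)) (g : E → ℝ) (hg : ContDiffOn ℝ ∞ g Ω) : 𝓓(Ω, ℝ) where
  toFun x := f x * g x
  contDiff' := contDiff_mul_of_tsupport Ω.isOpen f.contDiff f.tsupport_subset hg
  hasCompactSupport' := f.hasCompactSupport.mul_right
  tsupport_subset' :=
    (closure_mono (Function.support_mul_subset_left f g)).trans f.tsupport_subset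

theorem contDiffOn_inner_inv_pow (ν : EuclideanSpace ℝ (Fin n)) (m : ℕ) :
    ContDiffOn ℝ ∞ (fun x => (inner ℝ ν x ^ m)⁻¹) (halfSpace ν) := by
  refine ContDiffOn.inv ?_ fun x hx => pow_ne_zero _ (ne_of_gt hx)
  exact ((contDiff_const.inner ℝ contDiff_id).pow m).contDiffOn

/-- The test function `f / (ν ⬝ x)^m`. -/
def divNormalPow (f : 𝓓(halfSpace ν, ℝ)) (m : ℕ) : 𝓓(halfSpace ν, ℝ) :=
  mulTest f _ (contDiffOn_inner_inv_pow ν m)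

theorem divNormalPow_apply (f : 𝓓(halfSpace ν, ℝ)) (m : ℕ) (x : EuclideanSpace ℝ (Fin n)) :
    divNormalPow f m x = f x / inner ℝ ν x ^ m := rfl

theorem divNormalPow_sq (f : 𝓓(halfSpace ν, ℝ)) (m : ℕ) (x : EuclideanSpace ℝ (Fin n)) :
    divNormalPow f m x * divNormalPow f m x = f x ^ 2 / inner ℝ ν x ^ (2 * m) := by
  rw [divNormalPow_apply, div_mul_div_comm, ← pow_two, ← pow_two, ← pow_mul, mul_comm m]

theorem integrable_sq_div_inner_pow (f : 𝓓(halfSpace ν, ℝ)) (m : ℕ) :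
    Integrable fun x => f x ^ 2 / inner ℝ ν x ^ (2 * m) := by
  simpa only [divNormalPow_sq] using integrable_mul_test (divNormalPow f m) (divNormalPow f m)

/-- The weight depends on the normal variable alone, so it commutes with the tangential transform;
the weighted norm thus becomes a plain `L²` norm to which Plancherel applies. -/
theorem partialFourier_divNormalPow (ξ : hyperplane ν) (f : 𝓓(halfSpace ν, ℝ)) (m : ℕ) (t : ℝ) :
    partialFourier hν ξ (divNormalPow f m) t = partialFourier hν ξ f t / (t : ℂ) ^ m := by
  change partialFourierFun _ _ _ = partialFourierFun _ _ _ / _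
  rw [partialFourierFun_eq, partialFourierFun_eq, ← integral_div]
  congr 1
  ext x
  rw [divNormalPow_apply, inner_join hν]
  push_cast
  ring

theorem integrable_opIn_mul (m : ℕ) (a : (Fin n → ℕ) → ℝ) (f : 𝓓(halfSpace ν, ℝ)) :
    Integrable fun x => f x * operator m a f x := by
  rw [operator_eq]; exact integrable_mul_test _ _

/-- The Rellich inequality in the half-space with the Euclidean distance. -/
theorem rellich_halfSpace (hν : ‖ν‖ = 1) {m : ℕ} {a : (Fin n → ℕ) → ℝ} (hs : ∀ ξ, 0 ≤ symbol m a ξ)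
    (hsν : 0 < symbol m a ν) (f : 𝓓(halfSpace ν, ℝ)) :
    rellichConst m * symbol m a ν * ∫ x, f x ^ 2 / inner ℝ ν x ^ (2 * m) ≤
      ∫ x, f x * operator m a f x := by
  set g := opIn m a (fun i => dir ℝ (EuclideanSpace.single i 1)) f with hg
  set w := divNormalPow f m with hw
  have key : ∀ ξ : hyperplane ν, rellichConst m * symbol m a ν *
      (∫ t, conj (partialFourier hν ξ w t) * partialFourier hν ξ w t).re ≤
      (∫ t, conj (partialFourier hν ξ f t) * partialFourier hν ξ g t).re := by
    intro ξ
    obtain ⟨hdeg, hcoeff⟩ := natDegree_coeff_symbolPoly m a ξ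
    set c := symbol m a ν with hc
    have hq1 : (C c⁻¹ * symbolPoly m a ξ).coeff (2 * m) = 1 := by
      rw [Polynomial.coeff_C_mul, hcoeff, inv_mul_cancel₀ hsν.ne']
    have hq2 : (C c⁻¹ * symbolPoly m a ξ).natDegree ≤ 2 * m :=
      (Polynomial.natDegree_C_mul_le _ _).trans hdeg
    have hmain := rellich_line m (C c⁻¹ * symbolPoly m a ξ)
      (Polynomial.monic_of_natDegree_le_of_coeff_eq_one _ hq2 hq1)
      (Polynomial.natDegree_eq_of_le_of_coeff_ne_zero hq2 (by rw [hq1]; exact one_ne_zero))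
      (fun t => by
        rw [Polynomial.eval_mul, Polynomial.eval_C, eval_symbolPoly]
        exact mul_nonneg (inv_nonneg.mpr hsν.le) (hs _)) (partialFourier hν ξ f)
    have e1 : (∫ t, conj (partialFourier hν ξ w t) * partialFourier hν ξ w t).re =
        ∫ t, ‖partialFourier hν ξ f t‖ ^ 2 / t ^ (2 * m) := by
      simp only [Complex.conj_mul', ← Complex.ofReal_pow, integral_complex_ofReal,
        Complex.ofReal_re]
      congr 1
      ext t
      rw [hw, partialFourier_divNormalPow, norm_div, div_pow, norm_pow, Complex.norm_real,
        ← pow_mul, mul_comm m, pow_mul _ 2 m, pow_mul t, Real.norm_eq_abs, sq_abs]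
    have e2 : ∀ t, aeval (momentum posReals) (C c⁻¹ * symbolPoly m a ξ)
        (partialFourier hν ξ f) t = (c⁻¹ : ℂ) * partialFourier hν ξ g t := by
      intro t
      rw [map_mul, Polynomial.aeval_C, Module.End.mul_apply, ← partialFourier_operator]
      simp [Algebra.algebraMap_eq_smul_one, smul_apply, hg]
    simp only [e2, mul_left_comm _ (c⁻¹ : ℂ)] at hmain
    rw [integral_const_mul, ← Complex.ofReal_inv, Complex.re_ofReal_mul] at hmain
    rw [e1, mul_right_comm, mul_comm]
    calc _ ≤ c * _ := mul_le_mul_of_nonneg_left hmain hsν.le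
      _ = _ := mul_inv_cancel_left₀ hsν.ne' _
  have i1 : ∀ f g : 𝓓(halfSpace ν, ℝ), Integrable fun ξ : hyperplane ν =>
      ∫ t, conj (partialFourier hν ξ f t) * partialFourier hν ξ g t :=
    fun f g => (integrable_partialFourier hν f g).integral_prod_left
  have i2 : ∀ f g : 𝓓(halfSpace ν, ℝ), ∫ x, f x * g x = ∫ ξ : hyperplane ν,
      (∫ t, conj (partialFourier hν ξ f t) * partialFourier hν ξ g t).re := by
    intro f g
    have h := integral_re (i1 f g)
    simp only [RCLike.re_to_complex] at h
    rw [h, ← plancherel, Complex.ofReal_re]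
  rw [operator_eq, ← hg, i2 f g]
  simp only [← divNormalPow_sq]
  rw [← hw, i2 w w, ← integral_const_mul]
  exact integral_mono ((i1 w w).re.const_mul _) (i1 f g).re key

end

/-! ### The Finsler distance to the boundary of a half-space. -/

section

variable {n m : ℕ} {a : (Fin n → ℕ) → ℝ} {ν : EuclideanSpace ℝ (Fin n)}

theorem symbol_smul (c : ℝ) (ξ : EuclideanSpace ℝ (Fin n)) :
    symbol m a (c • ξ) = c ^ (2 * m) * symbol m a ξ := by
  rw [symbol, symbol, Finset.mul_sum]
  refine Finset.sum_congr rfl fun α hα => ?_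
  have : ∑ i, α i = 2 * m := by simpa [multiIndices] using hα
  rw [← this, ← Finset.prod_pow_eq_pow_sum, mul_left_comm, ← Finset.prod_mul_distrib]
  simp [mul_pow]

theorem continuous_symbol : Continuous (symbol (n := n) m a) := by
  unfold symbol
  fun_prop

theorem symbol_zero (hm : 1 ≤ m) : symbol m a (0 : EuclideanSpace ℝ (Fin n)) = 0 := by
  have := symbol_smul (m := m) (a := a) 0 (0 : EuclideanSpace ℝ (Fin n))
  rw [zero_smul, zero_pow (by omega), zero_mul] at this
  exact this

theorem IsElliptic.nonneg (ha : IsElliptic m a) (hm : 1 ≤ m) (ξ : EuclideanSpace ℝ (Fin n)) :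
    0 ≤ symbol m a ξ := by
  by_cases h : ξ = 0
  · rw [h, symbol_zero hm]
  · exact (ha ξ h).le

theorem IsElliptic.finsler_nonneg (ha : IsElliptic m a) (hm : 1 ≤ m)
    (ξ : EuclideanSpace ℝ (Fin n)) : 0 ≤ finsler m a ξ := Real.rpow_nonneg (ha.nonneg hm ξ) _

theorem IsElliptic.finsler_pos (ha : IsElliptic m a) {ξ : EuclideanSpace ℝ (Fin n)} (h : ξ ≠ 0) :
    0 < finsler m a ξ := Real.rpow_pos_of_pos (ha ξ h) _

theorem IsElliptic.finsler_pow (ha : IsElliptic m a) (hm : 1 ≤ m) (ξ : EuclideanSpace ℝ (Fin n)) :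
    finsler m a ξ ^ (2 * m) = symbol m a ξ := by
  rw [finsler, one_div, show (2 * m : ℝ) = ((2 * m : ℕ) : ℝ) by push_cast; rfl]
  exact Real.rpow_inv_natCast_pow (ha.nonneg hm ξ) (by omega)

theorem IsElliptic.finsler_smul (ha : IsElliptic m a) (hm : 1 ≤ m) (c : ℝ)
    (ξ : EuclideanSpace ℝ (Fin n)) : finsler m a (c • ξ) = |c| * finsler m a ξ := by
  have h0 := ha.finsler_nonneg hm
  refine (pow_left_inj₀ (h0 _) (mul_nonneg (abs_nonneg _) (h0 _))
    (show 2 * m ≠ 0 by omega)).mp ?_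
  rw [ha.finsler_pow hm, mul_pow, ha.finsler_pow hm, symbol_smul, pow_mul |c|, sq_abs, ← pow_mul]

/-- Compactness of the unit sphere and homogeneity. This bounds the quotients in `F_H^*`, without
which the real supremum would take its default value. In dimension `0` the sphere is empty. -/
theorem IsElliptic.exists_lower_bound (ha : IsElliptic m a) (hm : 1 ≤ m) :
    ∃ c : ℝ, 0 < c ∧ ∀ ξ : EuclideanSpace ℝ (Fin n), c * ‖ξ‖ ≤ finsler m a ξ := by
  have hcont : Continuous (finsler (n := n) m a) :=
    continuous_symbol.rpow_const fun _ => Or.inr (by positivity)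
  rcases (Metric.sphere (0 : EuclideanSpace ℝ (Fin n)) 1).eq_empty_or_nonempty with he | hne
  · refine ⟨1, one_pos, fun ξ => ?_⟩
    have hξ : ξ = 0 := by
      by_contra h
      have : (‖ξ‖⁻¹ • ξ) ∈ Metric.sphere (0 : EuclideanSpace ℝ (Fin n)) 1 := by
        simp [norm_smul, h]
      rw [he] at this
      exact this
    rw [hξ]
    simpa using ha.finsler_nonneg hm 0
  · obtain ⟨ξ₀, h0, hmin⟩ := (isCompact_sphere _ _).exists_isMinOn hne hcont.continuousOn
    have hξ₀ : ξ₀ ≠ 0 := by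
      rintro rfl
      simp at h0
    refine ⟨finsler m a ξ₀, ha.finsler_pos hξ₀, fun ξ => ?_⟩
    by_cases h : ξ = 0
    · rw [h]
      simpa using ha.finsler_nonneg hm 0
    · have hmem : (‖ξ‖⁻¹ • ξ) ∈ Metric.sphere (0 : EuclideanSpace ℝ (Fin n)) 1 := by
        simp [norm_smul, h]
      have h1 : finsler m a ξ₀ ≤ finsler m a (‖ξ‖⁻¹ • ξ) := hmin hmem
      rw [ha.finsler_smul hm, abs_of_nonneg (by positivity)] at h1
      have h2 : 0 < ‖ξ‖ := norm_pos_iff.mpr h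
      rwa [inv_mul_eq_div, le_div_iff₀ h2] at h1

theorem IsElliptic.bddAbove (ha : IsElliptic m a) (hm : 1 ≤ m) (w : EuclideanSpace ℝ (Fin n)) :
    BddAbove (range fun ξ : {ξ : EuclideanSpace ℝ (Fin n) // ξ ≠ 0} =>
      inner ℝ w (ξ : EuclideanSpace ℝ (Fin n)) / finsler m a ξ) := by
  obtain ⟨c, hc, h⟩ := ha.exists_lower_bound hm
  refine ⟨‖w‖ / c, ?_⟩
  rintro _ ⟨⟨ξ, hξ⟩, rfl⟩
  have h1 : 0 < finsler m a ξ := ha.finsler_pos hξ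
  rw [div_le_div_iff₀ h1 hc]
  calc inner ℝ w ξ * c ≤ ‖w‖ * ‖ξ‖ * c :=
        mul_le_mul_of_nonneg_right (real_inner_le_norm _ _) hc.le
    _ = ‖w‖ * (c * ‖ξ‖) := by ring
    _ ≤ _ := mul_le_mul_of_nonneg_left (h ξ) (norm_nonneg _)

theorem IsElliptic.le_finslerDual (ha : IsElliptic m a) (hm : 1 ≤ m)
    (w : EuclideanSpace ℝ (Fin n)) {ξ : EuclideanSpace ℝ (Fin n)} (hξ : ξ ≠ 0) :
    inner ℝ w ξ / finsler m a ξ ≤ finslerDual m a w :=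
  le_ciSup (ha.bddAbove hm w) (⟨ξ, hξ⟩ : {ξ : EuclideanSpace ℝ (Fin n) // ξ ≠ 0})

theorem finslerDual_smul {t : ℝ} (ht : 0 ≤ t) (w : EuclideanSpace ℝ (Fin n)) :
    finslerDual m a (t • w) = t * finslerDual m a w := by
  rw [finslerDual, finslerDual, Real.mul_iSup_of_nonneg ht]
  simp [real_inner_smul_left, mul_div_assoc]

theorem frontier_halfSpace (hν : ‖ν‖ = 1) :
    frontier (halfSpace ν : Set (EuclideanSpace ℝ (Fin n))) = {x | inner ℝ ν x = 0} := by
  apply Subset.antisymm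
  · intro x hx
    exact (frontier_lt_subset_eq continuous_const (by fun_prop) hx :
      (0 : ℝ) = inner ℝ ν x).symm
  · intro x hx
    rw [(halfSpace ν).isOpen.frontier_eq]
    refine ⟨?_, fun h => (ne_of_gt (show 0 < inner ℝ ν x from h)) hx⟩
    have h1 : Filter.Tendsto (fun ε : ℝ => x + ε • ν) (nhdsWithin 0 (Ioi 0)) (nhds x) := by
      have : Continuous fun ε : ℝ => x + ε • ν := by fun_prop
      simpa using (this.tendsto 0).mono_left nhdsWithin_le_nhds
    refine mem_closure_of_tendsto h1 ?_
    filter_upwards [self_mem_nhdsWithin] with ε hε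
    have hx' : inner ℝ ν x = 0 := hx
    change 0 < inner ℝ ν (x + ε • ν)
    simpa [inner_add_right, inner_smul_right, hν, hx'] using hε

/-- The distance to the boundary is proportional to the Euclidean one. -/
theorem finslerDist_eq (hν : ‖ν‖ = 1) {x : EuclideanSpace ℝ (Fin n)} (hx : x ∈ halfSpace ν) :
    finslerDist m a (halfSpace ν) x = inner ℝ ν x * finslerDist m a (halfSpace ν) ν := by
  have ht : 0 < inner ℝ ν x := hx
  set t : ℝ := inner ℝ ν x with htdef
  have key : (fun y => finslerDual m a (x - y)) '' frontier (halfSpace ν : Set _) =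
      t • (fun y => finslerDual m a (ν - y)) '' frontier (halfSpace ν : Set _) := by
    rw [frontier_halfSpace hν]
    ext r
    simp only [mem_image, mem_ofPred_eq, mem_smul_set]
    constructor
    · rintro ⟨y, hy, rfl⟩
      refine ⟨_, ⟨ν - t⁻¹ • (x - y), ?_, rfl⟩, ?_⟩
      · simp [inner_sub_right, inner_smul_right, hν, hy, ← htdef, ht.ne']
      · rw [smul_eq_mul, ← finslerDual_smul ht.le, sub_sub_cancel, smul_inv_smul₀ ht.ne']
    · rintro ⟨_, ⟨y, hy, rfl⟩, rfl⟩
      refine ⟨x - t • (ν - y), ?_, ?_⟩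
      · simp [inner_sub_right, inner_smul_right, hν, hy, ← htdef]
      · rw [sub_sub_cancel, finslerDual_smul ht.le, smul_eq_mul]
  rw [finslerDist, key, Real.sInf_smul_of_nonneg ht.le, smul_eq_mul, finslerDist]

/-- Take `ξ = ν` in the supremum: `(ν - y) ⬝ ν = 1` for every boundary point `y`. Convexity plays no
role. -/
theorem IsElliptic.inv_finsler_le (ha : IsElliptic m a) (hm : 1 ≤ m) (hν : ‖ν‖ = 1)
    {y : EuclideanSpace ℝ (Fin n)}
    (hy : y ∈ frontier (halfSpace ν : Set (EuclideanSpace ℝ (Fin n)))) :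
    (finsler m a ν)⁻¹ ≤ finslerDual m a (ν - y) := by
  rw [frontier_halfSpace hν] at hy
  have hy' : inner ℝ ν y = 0 := hy
  have hν0 : ν ≠ 0 := by rintro rfl; simp at hν
  have := ha.le_finslerDual hm (ν - y) hν0
  rwa [inner_sub_left, real_inner_self_eq_norm_sq, hν, real_inner_comm, hy', one_pow, sub_zero,
    one_div] at this

theorem IsElliptic.inv_finsler_le_finslerDist (ha : IsElliptic m a) (hm : 1 ≤ m) (hν : ‖ν‖ = 1) :
    (finsler m a ν)⁻¹ ≤ finslerDist m a (halfSpace ν) ν := by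
  refine le_csInf ⟨_, mem_image_of_mem _ (?_ : (0 : EuclideanSpace ℝ (Fin n)) ∈ _)⟩ ?_
  · rw [frontier_halfSpace hν]; simp
  · rintro _ ⟨y, hy, rfl⟩
    exact ha.inv_finsler_le hm hν hy

/-- A convex `F_H` has a supporting functional at `ν`. -/
theorem IsElliptic.exists_support (ha : IsElliptic m a) (hm : 1 ≤ m)
    (hconv : ConvexOn ℝ univ (finsler (n := n) m a)) (hν0 : ν ≠ 0) :
    ∃ w : EuclideanSpace ℝ (Fin n), inner ℝ w ν = finsler m a ν ∧
      ∀ ξ, inner ℝ w ξ ≤ finsler m a ξ := by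
  obtain ⟨g, hg1, hg2⟩ := exists_extension_of_le_sublinear
    (LinearPMap.mkSpanSingleton ν (finsler m a ν) hν0) (finsler m a)
    (fun c hc x => by rw [ha.finsler_smul hm, abs_of_pos hc])
    (fun x y => by
      have h := hconv.2 (mem_univ x) (mem_univ y) (show (0 : ℝ) ≤ 1 / 2 by norm_num)
        (show (0 : ℝ) ≤ 1 / 2 by norm_num) (by norm_num)
      rw [← smul_add, ha.finsler_smul hm, abs_of_pos (by norm_num)] at h
      simp only [smul_eq_mul] at h
      linarith)
    (by
      rintro ⟨x, hx⟩
      obtain ⟨c, rfl⟩ := Submodule.mem_span_singleton.mp hx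
      rw [LinearPMap.mkSpanSingleton'_apply, RingHom.id_apply, ha.finsler_smul hm]
      exact mul_le_mul_of_nonneg_right (le_abs_self c) (ha.finsler_pos hν0).le)
  refine ⟨(InnerProductSpace.toDual ℝ _).symm (LinearMap.toContinuousLinearMap g), ?_, ?_⟩
  · rw [InnerProductSpace.toDual_symm_apply]
    have := hg1 ⟨ν, Submodule.mem_span_singleton_self ν⟩
    have h2 := LinearPMap.mkSpanSingleton_apply ℝ ℝ (σ := RingHom.id ℝ) hν0 (finsler m a ν)
    exact this.trans h2
  · intro ξ
    rw [InnerProductSpace.toDual_symm_apply]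
    exact hg2 ξ

/-- A supporting functional `w` at `ν` satisfies `F_H^*(w) ≤ 1` and `w ⬝ ν = F_H(ν)`. Hence `ν - w /
F_H(ν)` lies on the boundary, at distance at most `1 / F_H(ν)` from `ν`. -/
theorem IsElliptic.finslerDist_normal (ha : IsElliptic m a) (hm : 1 ≤ m) (hν : ‖ν‖ = 1)
    (hconv : ConvexOn ℝ univ (finsler (n := n) m a)) :
    finslerDist m a (halfSpace ν) ν = (finsler m a ν)⁻¹ := by
  have hν0 : ν ≠ 0 := by rintro rfl; simp at hν
  refine le_antisymm ?_ (ha.inv_finsler_le_finslerDist hm hν)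
  obtain ⟨w, h1, h2⟩ := ha.exists_support hm hconv hν0
  have hF := ha.finsler_pos hν0
  have hy : ν - (finsler m a ν)⁻¹ • w ∈
      frontier (halfSpace ν : Set (EuclideanSpace ℝ (Fin n))) := by
    rw [frontier_halfSpace hν]
    change inner ℝ ν _ = 0
    rw [inner_sub_right, inner_smul_right, real_inner_comm w, h1, real_inner_self_eq_norm_sq, hν,
      inv_mul_cancel₀ hF.ne']
    norm_num
  refine (csInf_le ⟨(finsler m a ν)⁻¹, ?_⟩ (mem_image_of_mem _ hy)).trans ?_
  · rintro _ ⟨y, hy, rfl⟩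
    exact ha.inv_finsler_le hm hν hy
  · rw [sub_sub_cancel, finslerDual_smul (by positivity)]
    have : finslerDual m a w ≤ 1 := by
      have : Nonempty {ξ : EuclideanSpace ℝ (Fin n) // ξ ≠ 0} := ⟨⟨ν, hν0⟩⟩
      refine ciSup_le fun ξ => ?_
      exact (div_le_one (ha.finsler_pos ξ.2)).mpr (h2 ξ)
    simpa using mul_le_mul_of_nonneg_left this (inv_nonneg.mpr hF.le)

end

/-! ### Optimality: reduction to the normal direction. -/

section

variable {n m : ℕ} {a : (Fin n → ℕ) → ℝ} {ν : EuclideanSpace ℝ (Fin n)}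

/-- The pairing `Q ↦ ∫ f Q f` as a linear functional of the operator `Q`. -/
def pairing {E : Type*} [NormedAddCommGroup E] [NormedSpace ℝ E]
    [MeasurableSpace E] [OpensMeasurableSpace E] (μ : Measure E) [IsFiniteMeasureOnCompacts μ]
    {Ω : TopologicalSpace.Opens E} (f : 𝓓(Ω, ℝ)) : Module.End ℝ 𝓓(Ω, ℝ) →ₗ[ℝ] ℝ where
  toFun Q := ∫ x, f x * Q f x ∂μ
  map_add' P Q := by
    rw [← integral_add (integrable_mul_test f _) (integrable_mul_test f _)]
    simp [add_apply, mul_add]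
  map_smul' c Q := by
    simp only [LinearMap.smul_apply, smul_apply, smul_eq_mul, RingHom.id_apply, mul_left_comm _ c]
    rw [integral_const_mul]

theorem pairing_apply {E : Type*} [NormedAddCommGroup E] [NormedSpace ℝ E]
    [MeasurableSpace E] [OpensMeasurableSpace E] (μ : Measure E) [IsFiniteMeasureOnCompacts μ]
    {Ω : TopologicalSpace.Opens E} (f : 𝓓(Ω, ℝ)) (Q : Module.End ℝ 𝓓(Ω, ℝ)) :
    pairing μ f Q = ∫ x, f x * Q f x ∂μ := rfl

section Stretch

/-- Composition of test functions with a linear equivalence. -/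
def compEquiv {E : Type*} [NormedAddCommGroup E] [NormedSpace ℝ E]
    {Ω Ω' : TopologicalSpace.Opens E} (S : E ≃L[ℝ] E) (hS : ∀ x, S x ∈ Ω → x ∈ Ω') :
    𝓓(Ω, ℝ) →ₗ[ℝ] 𝓓(Ω', ℝ) where
  toFun f :=
    { toFun := fun x => f (S x)
      contDiff' := f.contDiff.comp S.contDiff
      hasCompactSupport' := f.hasCompactSupport.comp_homeomorph S.toHomeomorph
      tsupport_subset' := by
        have : tsupport (f ∘ S) ⊆ S ⁻¹' tsupport f :=
          closure_minimal (fun x hx => subset_tsupport f hx)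
            ((isClosed_tsupport f).preimage S.continuous)
        exact fun x hx => hS x (f.tsupport_subset (this hx)) }
  map_add' f g := by ext x; rfl
  map_smul' c f := by ext x; rfl

variable {E : Type*} [NormedAddCommGroup E] [NormedSpace ℝ E]
  {Ω Ω' : TopologicalSpace.Opens E} (S : E ≃L[ℝ] E) (hS : ∀ x, S x ∈ Ω → x ∈ Ω')

theorem compEquiv_apply (f : 𝓓(Ω, ℝ)) (x : E) :
    (compEquiv S hS f : 𝓓(Ω', ℝ)) x = f (S x) := rfl

theorem compEquiv_dir (v : E) (f : 𝓓(Ω, ℝ)) :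
    (compEquiv S hS (dir ℝ (S v) f) : 𝓓(Ω', ℝ)) = dir ℝ v (compEquiv S hS f) := by
  ext x
  rw [compEquiv_apply, dir_eq_fderiv, dir_eq_fderiv]
  have h : HasFDerivAt (compEquiv S hS f : 𝓓(Ω', ℝ)) _ x :=
    (differentiable_test f (S x)).hasFDerivAt.comp x S.hasFDerivAt
  rw [h.fderiv]
  rfl

theorem exists_integral_comp_equiv [FiniteDimensional ℝ E] [MeasurableSpace E] [BorelSpace E]
    (μ : Measure E) [μ.IsAddHaarMeasure] :
    ∃ c : ℝ, 0 < c ∧ ∀ f : E → ℝ, ∫ x, f (S x) ∂μ = c * ∫ x, f x ∂μ := by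
  have hdet : LinearMap.det (S : E →ₗ[ℝ] E) ≠ 0 := (LinearEquiv.isUnit_det' S.toLinearEquiv).ne_zero
  refine ⟨|(LinearMap.det (S : E →ₗ[ℝ] E))⁻¹|, abs_pos.mpr (inv_ne_zero hdet), fun f => ?_⟩
  have h1 := Measure.map_linearMap_addHaar_eq_smul_addHaar μ hdet
  have h2 := S.toHomeomorph.measurableEmbedding.integral_map (μ := μ) f
  have e : Measure.map S μ = Measure.map (S : E →ₗ[ℝ] E) μ := rfl
  change ∫ y, f y ∂Measure.map S μ = ∫ x, f (S x) ∂μ at h2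
  rw [← h2, e, h1, integral_smul_measure, ENNReal.toReal_ofReal (abs_nonneg _), smul_eq_mul]

end Stretch

/-- The map `x ↦ επx + (ν ⬝ x)ν`, where `π` is the projection onto the hyperplane. -/
def stretchFun (ν : EuclideanSpace ℝ (Fin n)) (ε : ℝ) :
    EuclideanSpace ℝ (Fin n) →ₗ[ℝ] EuclideanSpace ℝ (Fin n) :=
  ε • (LinearMap.id - (innerₗ _ ν).smulRight ν) + (innerₗ _ ν).smulRight ν

theorem stretchFun_apply (ε : ℝ) (x : EuclideanSpace ℝ (Fin n)) :
    stretchFun ν ε x = ε • (x - inner ℝ ν x • ν) + inner ℝ ν x • ν := by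
  simp [stretchFun]

theorem inner_stretchFun (hν : ‖ν‖ = 1) (ε : ℝ) (x : EuclideanSpace ℝ (Fin n)) :
    inner ℝ ν (stretchFun ν ε x) = inner ℝ ν x := by
  rw [stretchFun_apply]
  simp [inner_add_right, inner_smul_right, inner_sub_right, hν]

theorem stretchFun_stretchFun (hν : ‖ν‖ = 1) {ε δ : ℝ} (h : ε * δ = 1)
    (x : EuclideanSpace ℝ (Fin n)) : stretchFun ν ε (stretchFun ν δ x) = x := by
  rw [stretchFun_apply, inner_stretchFun hν, stretchFun_apply, add_sub_cancel_right, smul_smul, h,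
    one_smul, sub_add_cancel]

/-- For `ε ≠ 0` the map `x ↦ επx + (ν ⬝ x)ν` is invertible. -/
def stretch (hν : ‖ν‖ = 1) {ε : ℝ} (hε : ε ≠ 0) :
    EuclideanSpace ℝ (Fin n) ≃L[ℝ] EuclideanSpace ℝ (Fin n) :=
  LinearEquiv.toContinuousLinearEquiv
    { stretchFun ν ε with
      invFun := stretchFun ν ε⁻¹
      left_inv := stretchFun_stretchFun hν (inv_mul_cancel₀ hε)
      right_inv := stretchFun_stretchFun hν (mul_inv_cancel₀ hε) }

theorem stretch_apply (hν : ‖ν‖ = 1) {ε : ℝ} (hε : ε ≠ 0) (x : EuclideanSpace ℝ (Fin n)) :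
    stretch hν hε x = stretchFun ν ε x := rfl

/-- All the derivatives are multiples `ν i` of the single operator `∂_ν`, so the identity can be
computed among polynomials in one variable, where homogeneity applies. -/
theorem opIn_dir_normal {Ω : TopologicalSpace.Opens (EuclideanSpace ℝ (Fin n))} :
    opIn m a (fun i => (dir ℝ (ν i • ν) : Module.End ℝ 𝓓(Ω, ℝ))) =
      ((-1) ^ m * symbol m a ν) • dir ℝ ν ^ (2 * m) := by
  have h1 := map_opIn (aeval (dir ℝ ν : Module.End ℝ 𝓓(Ω, ℝ))) m a
    (fun i => X * C (ν i))
  have h2 := map_opIn (Algebra.ofId ℝ (Polynomial ℝ)) m a (fun i => ν i)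
  have e : ∀ i, aeval (dir ℝ ν : Module.End ℝ 𝓓(Ω, ℝ)) (X * C (ν i)) = dir ℝ (ν i • ν) := by
    intro i
    ext f x
    simp [dir_eq_fderiv, Algebra.algebraMap_eq_smul_one]
  simp only [e] at h1
  rw [← h1, opIn_smul]
  change C (opIn m a fun i => ν i) = opIn m a (fun i => C (ν i)) at h2
  rw [← h2, opIn_real, map_mul, map_pow, Polynomial.aeval_X, Polynomial.aeval_C, ← Algebra.commutes,
    Algebra.smul_def]

/-- An inequality for `H` in the half-space reduces to one for its normal part. -/
theorem normal_inequality (hν : ‖ν‖ = 1) {K : ℝ}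
    (h : ∀ u : 𝓓(halfSpace ν, ℝ), K * ∫ x, u x ^ 2 / inner ℝ ν x ^ (2 * m) ≤
      ∫ x, u x * operator m a u x) (u : 𝓓(halfSpace ν, ℝ)) :
    K * ∫ x, u x ^ 2 / inner ℝ ν x ^ (2 * m) ≤
      (-1) ^ m * symbol m a ν * ∫ x, u x * (dir ℝ ν ^ (2 * m)) u x := by
  let e := fun i : Fin n => EuclideanSpace.single i (1 : ℝ)
  have hin : ∀ i, inner ℝ ν (e i) = ν i := by
    intro i
    simp [e, EuclideanSpace.inner_single_right]
  let A : Fin n → Module.End ℝ 𝓓(halfSpace ν, ℝ) := fun i => dir ℝ (e i - inner ℝ ν (e i) • ν)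
  let B : Fin n → Module.End ℝ 𝓓(halfSpace ν, ℝ) := fun i => dir ℝ (ν i • ν)
  have hcont := continuous_opIn m a A B (pairing volume u)
  have hpos : ∀ ε : ℝ, 0 < ε → K * ∫ x, u x ^ 2 / inner ℝ ν x ^ (2 * m) ≤
      pairing volume u (opIn m a fun i => ε • A i + B i) := by
    intro ε hε
    have hS : ∀ x, stretch hν hε.ne' x ∈ halfSpace ν → x ∈ halfSpace ν := by
      intro x hx
      have h1 : 0 < inner ℝ ν (stretch hν hε.ne' x) := hx
      rwa [stretch_apply, inner_stretchFun hν] at h1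
    obtain ⟨c, hc, hint⟩ := exists_integral_comp_equiv (stretch hν hε.ne')
      (volume : Measure (EuclideanSpace ℝ (Fin n)))
    have h1 := h (compEquiv (stretch hν hε.ne') hS u)
    -- The stretch sends `e i` to `ε (e i - ν i • ν) + ν i • ν`, so the chain rule scales only
    -- tangential derivatives by `ε`.
    have hd : ∀ i f, compEquiv (stretch hν hε.ne') hS ((ε • A i + B i) f) =
        dir ℝ (e i) (compEquiv (stretch hν hε.ne') hS f) := by
      intro i f
      rw [← compEquiv_dir, stretch_apply, stretchFun_apply, dir_add_smul, hin]
      simp only [A, B, hin]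
    have h2 := intertwine_opIn (compEquiv (stretch hν hε.ne') hS) m a _ _ hd u
    rw [operator_eq, ← h2] at h1
    simp only [compEquiv_apply] at h1
    have e1 := hint (fun x => u x ^ 2 / inner ℝ ν x ^ (2 * m))
    have e2 := hint (fun x => u x * opIn m a (fun i => ε • A i + B i) u x)
    simp only [stretch_apply, inner_stretchFun hν] at e1 e2 h1
    rw [e1, e2, mul_left_comm] at h1
    exact le_of_mul_le_mul_left h1 hc
  -- The weight is invariant under the stretch and the Jacobian has cancelled, so `ε` remains only
  -- in the operator, where it can tend to `0`.
  have hlim := (hcont.tendsto 0).mono_left (nhdsWithin_le_nhds (s := Ioi 0))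
  have h0 := ge_of_tendsto hlim (by
    filter_upwards [self_mem_nhdsWithin] with ε hε using hpos ε hε)
  simp only [zero_smul, zero_add, B] at h0
  rw [opIn_dir_normal, map_smul, pairing_apply, smul_eq_mul] at h0
  exact h0

section Product

/-- The function `φ(πx) ψ(ν ⬝ x)`. -/
def tensor (hν : ‖ν‖ = 1) (φ : 𝓓((⊤ : TopologicalSpace.Opens (hyperplane ν)), ℝ)) :
    𝓓(posReals, ℝ) →ₗ[ℝ] 𝓓(halfSpace ν, ℝ) where
  toFun ψ :=
    have hsupp : Function.support (fun x => φ ((hyperplane ν).orthogonalProjectionOnto x) *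
        ψ (inner ℝ ν x)) ⊆ (fun p : hyperplane ν × ℝ => (p.1 : EuclideanSpace ℝ (Fin n)) + p.2 • ν) ''
          (tsupport φ ×ˢ tsupport ψ) := by
      intro x hx
      refine ⟨((hyperplane ν).orthogonalProjectionOnto x, inner ℝ ν x),
        ⟨subset_tsupport _ (left_ne_zero_of_mul hx), subset_tsupport _ (right_ne_zero_of_mul hx)⟩, ?_⟩
      have h1 := (Submodule.span ℝ {ν}).starProjection_add_starProjection_orthogonal x
      rw [Submodule.starProjection_unit_singleton ℝ hν] at h1
      simpa [add_comm] using h1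
    have hcomp := (φ.hasCompactSupport.prod ψ.hasCompactSupport).image (continuous_join (ν := ν))
    { toFun := fun x => φ ((hyperplane ν).orthogonalProjectionOnto x) * ψ (inner ℝ ν x)
      contDiff' := (φ.contDiff.comp (hyperplane ν).orthogonalProjectionOnto.contDiff).mul
        (ψ.contDiff.comp (contDiff_const.inner ℝ contDiff_id))
      hasCompactSupport' := HasCompactSupport.of_support_subset_isCompact hcomp hsupp
      tsupport_subset' := by
        refine (closure_minimal hsupp hcomp.isClosed).trans ?_
        rintro _ ⟨⟨x, t⟩, ⟨_, ht⟩, rfl⟩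
        change 0 < inner ℝ ν _
        rw [inner_join hν]
        exact ψ.tsupport_subset ht }
  map_add' f g := by
    ext x
    exact mul_add _ _ _
  map_smul' c f := by
    ext x
    exact mul_left_comm _ _ _

variable (hν : ‖ν‖ = 1) (φ : 𝓓((⊤ : TopologicalSpace.Opens (hyperplane ν)), ℝ))

theorem tensor_apply (ψ : 𝓓(posReals, ℝ)) (x : EuclideanSpace ℝ (Fin n)) :
    tensor hν φ ψ x = φ ((hyperplane ν).orthogonalProjectionOnto x) * ψ (inner ℝ ν x) := rfl

theorem orthogonalProjection_join (x : hyperplane ν) (t : ℝ) :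
    (hyperplane ν).orthogonalProjectionOnto ((x : EuclideanSpace ℝ (Fin n)) + t • ν) = x := by
  have h : (hyperplane ν).orthogonalProjectionOnto ν = 0 :=
    Submodule.orthogonalProjectionOnto_orthogonalComplement_singleton_eq_zero ν
  simp [h]

theorem tensor_join (ψ : 𝓓(posReals, ℝ)) (x : hyperplane ν) (t : ℝ) :
    tensor hν φ ψ ((x : EuclideanSpace ℝ (Fin n)) + t • ν) = φ x * ψ t := by
  rw [tensor_apply, orthogonalProjection_join, inner_join hν]

theorem tensor_dir (ψ : 𝓓(posReals, ℝ)) :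
    tensor hν φ (dir ℝ (1 : ℝ) ψ) = dir ℝ ν (tensor hν φ ψ) := by
  ext x
  rw [dir_apply, lineDeriv, tensor_apply, dir_one_apply]
  have e : (fun t : ℝ => tensor hν φ ψ (x + t • ν)) =
      fun t => φ ((hyperplane ν).orthogonalProjectionOnto x) * ψ (inner ℝ ν x + t) := by
    ext t
    have h : (hyperplane ν).orthogonalProjectionOnto ν = 0 :=
      Submodule.orthogonalProjectionOnto_orthogonalComplement_singleton_eq_zero ν
    simp [tensor_apply, h, inner_add_right, inner_smul_right, hν]
  rw [e]
  have h1 : HasDerivAt (fun t : ℝ => ψ (inner ℝ ν x + t)) (deriv ψ (inner ℝ ν x)) 0 := by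
    have := hasDerivAt_test ψ (inner ℝ ν x + 0)
    simpa using this.comp_const_add (inner ℝ ν x) 0
  exact (h1.const_mul _).deriv.symm

theorem tensor_dir_pow (k : ℕ) (ψ : 𝓓(posReals, ℝ)) :
    tensor hν φ ((dir ℝ (1 : ℝ) ^ k) ψ) = (dir ℝ ν ^ k) (tensor hν φ ψ) := by
  induction k generalizing ψ with
  | zero => rfl
  | succ k ih => rw [pow_succ, Module.End.mul_apply, ih, tensor_dir, pow_succ]; rfl

theorem integral_tensor_mul (ψ χ : 𝓓(posReals, ℝ)) :
    ∫ x, tensor hν φ ψ x * tensor hν φ χ x = (∫ x, φ x ^ 2) * ∫ t, ψ t * χ t := by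
  rw [integral_join hν (f := fun x => tensor hν φ ψ x * tensor hν φ χ x)
    ((tensor hν φ ψ).continuous.mul (tensor hν φ χ).continuous), Measure.volume_eq_prod,
    ← integral_prod_mul]
  congr 1
  ext p
  rw [tensor_join, tensor_join]
  ring

theorem integral_tensor_sq_div (ψ : 𝓓(posReals, ℝ)) :
    ∫ x, tensor hν φ ψ x ^ 2 / inner ℝ ν x ^ (2 * m) =
      (∫ x, φ x ^ 2) * ∫ t, ψ t ^ 2 / t ^ (2 * m) := by
  simp only [← divNormalPow_sq]
  rw [integral_join hν
    (f := fun x => divNormalPow (tensor hν φ ψ) m x * divNormalPow (tensor hν φ ψ) m x)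
    ((TestFunction.continuous _).mul (TestFunction.continuous _)), Measure.volume_eq_prod,
    ← integral_prod_mul]
  congr 1
  ext p
  rw [divNormalPow_sq, tensor_join, inner_join hν]
  ring

/-- There is a test function on the whole space with positive `L²` norm. -/
theorem exists_test_pos (V : Type*) [NormedAddCommGroup V] [InnerProductSpace ℝ V]
    [FiniteDimensional ℝ V] [MeasurableSpace V] [BorelSpace V] :
    ∃ φ : 𝓓((⊤ : TopologicalSpace.Opens V), ℝ), 0 < ∫ x, φ x ^ 2 := by
  let b : ContDiffBump (0 : V) := default
  let φ : 𝓓((⊤ : TopologicalSpace.Opens V), ℝ) :=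
    ⟨b, b.contDiff, b.hasCompactSupport, subset_univ _⟩
  refine ⟨φ, Continuous.integral_pos_of_hasCompactSupport_nonneg_nonzero (x := 0) ?_ ?_ ?_ ?_⟩
  · fun_prop
  · exact φ.hasCompactSupport.comp_left (g := fun z => z ^ 2) (by simp)
  · exact fun x => sq_nonneg _
  · have : φ 0 = 1 := b.one_of_mem_closedBall (by simp [b.rIn_pos.le])
    simp [this]

/-- For a product `φ(πx) ψ(ν ⬝ x)` the normal inequality contains the factor `∫ φ²` on both sides,
and it is positive. -/
theorem line_inequality (hν : ‖ν‖ = 1) {K : ℝ}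
    (h : ∀ u : 𝓓(halfSpace ν, ℝ), K * ∫ x, u x ^ 2 / inner ℝ ν x ^ (2 * m) ≤
      ∫ x, u x * operator m a u x) (ψ : 𝓓(posReals, ℝ)) :
    K * ∫ t, ψ t ^ 2 / t ^ (2 * m) ≤
      (-1) ^ m * symbol m a ν * ∫ t, ψ t * (dir ℝ (1 : ℝ) ^ (2 * m)) ψ t := by
  obtain ⟨φ, hφ⟩ := exists_test_pos (hyperplane ν)
  have h1 := normal_inequality hν h (tensor hν φ ψ)
  rw [integral_tensor_sq_div, ← tensor_dir_pow, integral_tensor_mul, mul_left_comm,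
    mul_left_comm _ (∫ x, φ x ^ 2)] at h1
  exact le_of_mul_le_mul_left h1 hφ

end Product

end

/-! ### Optimality on the half-line by logarithmic variables. -/

/-- The polynomial `∏_{j < k} (X + a - j)`, describing the `k`-th derivative of `t^a f(log t)`. -/
def eulerPoly (a : ℝ) (k : ℕ) : Polynomial ℝ := ∏ j ∈ Finset.range k, (X + C (a - j))

/-- Passing from `m` to `m + 1` adds one factor at each end of the product, `m + 1/2` and `-(m +
1/2)`, and shifts the index of the others. -/
theorem eval_zero_eulerPoly (m : ℕ) :
    (-1) ^ m * (eulerPoly (m - 1 / 2) (2 * m)).eval 0 = rellichConst m := by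
  simp only [eulerPoly, Polynomial.eval_prod, Polynomial.eval_add, Polynomial.eval_X,
    Polynomial.eval_C, zero_add]
  induction m with
  | zero => simp [rellichConst_zero]
  | succ m ih =>
    rw [rellichConst_succ, ← ih, show 2 * (m + 1) = 2 * m + 1 + 1 by ring, Finset.prod_range_succ,
      Finset.prod_range_succ']
    have : ∀ k : ℕ, (((m + 1 : ℕ) : ℝ) - 1 / 2 - ((k + 1 : ℕ) : ℝ)) = m - 1 / 2 - k := by
      intro k; push_cast; ring
    simp only [this]
    push_cast
    ring

theorem intertwine_aeval {M N : Type*} [AddCommGroup M] [Module ℝ M] [AddCommGroup N] [Module ℝ N]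
    (T : M →ₗ[ℝ] N) (d : Module.End ℝ M) (d' : Module.End ℝ N) (h : ∀ f, T (d f) = d' (T f))
    (p : Polynomial ℝ) (f : M) : T (aeval d p f) = aeval d' p (T f) := by
  have hpow : ∀ k f, T ((d ^ k) f) = (d' ^ k) (T f) := by
    intro k
    induction k with
    | zero => intro f; rfl
    | succ k ih => intro f; rw [pow_succ, Module.End.mul_apply, ih, h, pow_succ]; rfl
  simp [Polynomial.aeval_eq_sum_range, LinearMap.sum_apply, hpow]

theorem tendsto_aeval_smul {A : Type*} [Ring A] [Algebra ℝ A] (L : A →ₗ[ℝ] ℝ) (d : A)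
    (p : Polynomial ℝ) :
    Filter.Tendsto (fun ε : ℝ => L (aeval (ε • d) p)) (nhds 0) (nhds (p.eval 0 * L 1)) := by
  have h : Continuous fun ε : ℝ => L (aeval (ε • d) p) := by
    simp only [Polynomial.aeval_eq_sum_range, smul_pow, map_sum, map_smul, smul_eq_mul]
    fun_prop
  have h0 := h.tendsto 0
  have e : L (aeval ((0 : ℝ) • d) p) = p.eval 0 * L 1 := by
    rw [zero_smul, ← map_zero (algebraMap ℝ A), Polynomial.aeval_algebraMap_apply,
      Algebra.algebraMap_eq_smul_one, map_smul, Polynomial.coe_aeval_eq_eval, smul_eq_mul]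
  rwa [e] at h0

/-- The function `t^a f(log t)` on the half-line. -/
def powLogFun (a : ℝ) (f : ℝ → ℝ) (t : ℝ) : ℝ := if 0 < t then t ^ a * f (Real.log t) else 0

theorem powLogFun_of_pos (a : ℝ) (f : ℝ → ℝ) {t : ℝ} (ht : 0 < t) :
    powLogFun a f t = t ^ a * f (Real.log t) := if_pos ht

theorem powLogFun_eventuallyEq (a : ℝ) (f : ℝ → ℝ) {t : ℝ} (ht : 0 < t) :
    powLogFun a f =ᶠ[nhds t] fun t => t ^ a * f (Real.log t) := by
  filter_upwards [Ioi_mem_nhds ht] with s hs using powLogFun_of_pos a f hs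

theorem support_powLogFun (a : ℝ) (f : ℝ → ℝ) :
    Function.support (powLogFun a f) ⊆ Real.exp '' tsupport f := by
  intro t ht
  have h0 : 0 < t := by
    by_contra h
    exact ht (if_neg h)
  refine ⟨Real.log t, subset_tsupport f fun h => ht ?_, Real.exp_log h0⟩
  rw [powLogFun_of_pos a f h0, h, mul_zero]

theorem contDiff_powLogFun (a : ℝ) (f : 𝓓((⊤ : TopologicalSpace.Opens ℝ), ℝ)) :
    ContDiff ℝ ∞ (powLogFun a f) := by
  have hK : IsCompact (Real.exp '' tsupport f) := f.hasCompactSupport.image Real.continuous_exp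
  refine contDiff_iff_contDiffAt.mpr fun t => ?_
  by_cases ht : t ∈ Real.exp '' tsupport f
  · have h0 : 0 < t := by
      obtain ⟨s, _, rfl⟩ := ht
      exact Real.exp_pos s
    refine ContDiffAt.congr_of_eventuallyEq ?_ (powLogFun_eventuallyEq a f h0)
    exact (Real.contDiffAt_rpow_const_of_ne h0.ne').mul
      (f.contDiff.contDiffAt.comp t (Real.contDiffAt_log.mpr h0.ne'))
  · refine (contDiffAt_const (c := (0 : ℝ))).congr_of_eventuallyEq ?_
    filter_upwards [hK.isClosed.isOpen_compl.mem_nhds ht] with s hs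
    exact Function.notMem_support.mp fun h => hs (support_powLogFun a f h)

/-- The map `f ↦ t^a f(log t)` on test functions. -/
def powLog (a : ℝ) : 𝓓((⊤ : TopologicalSpace.Opens ℝ), ℝ) →ₗ[ℝ] 𝓓(posReals, ℝ) where
  toFun f :=
    { toFun := powLogFun a f
      contDiff' := contDiff_powLogFun a f
      hasCompactSupport' := HasCompactSupport.of_support_subset_isCompact
        (f.hasCompactSupport.image Real.continuous_exp) (support_powLogFun a f)
      tsupport_subset' := by
        refine (closure_minimal (support_powLogFun a f)
          (f.hasCompactSupport.image Real.continuous_exp).isClosed).trans ?_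
        rintro _ ⟨s, _, rfl⟩
        exact Real.exp_pos s }
  map_add' f g := by
    ext t
    change powLogFun a _ t = powLogFun a f t + powLogFun a g t
    unfold powLogFun
    split_ifs
    · rw [add_apply, mul_add]
    · rw [add_zero]
  map_smul' c f := by
    ext t
    change powLogFun a _ t = c * powLogFun a f t
    unfold powLogFun
    split_ifs
    · rw [smul_apply, smul_eq_mul, mul_left_comm]
    · rw [mul_zero]

theorem powLog_apply (a : ℝ) (f : 𝓓((⊤ : TopologicalSpace.Opens ℝ), ℝ)) (t : ℝ) :
    powLog a f t = powLogFun a f t := rfl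

theorem powLog_of_nonpos (a : ℝ) (f : 𝓓((⊤ : TopologicalSpace.Opens ℝ), ℝ)) {t : ℝ} (ht : t ≤ 0) :
    powLog a f t = 0 := if_neg ht.not_gt

theorem dir_powLog (a : ℝ) (f : 𝓓((⊤ : TopologicalSpace.Opens ℝ), ℝ)) :
    dir ℝ (1 : ℝ) (powLog a f) =
      powLog (a - 1) (aeval (dir ℝ (1 : ℝ)) (X + C a : Polynomial ℝ) f) := by
  ext t
  rw [dir_one_apply]
  rcases le_or_gt t 0 with ht | ht
  · rw [powLog_of_nonpos _ _ ht]
    have h0 : t ∉ tsupport (powLog a f) := fun h =>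
      absurd ((powLog a f).tsupport_subset h) (not_lt.mpr ht)
    have h1 : powLog a f =ᶠ[nhds t] fun _ => 0 := notMem_tsupport_iff_eventuallyEq.mp h0
    rw [h1.deriv_eq, deriv_const]
  · have h1 : powLog a f =ᶠ[nhds t] fun t => t ^ a * f (Real.log t) :=
      powLogFun_eventuallyEq a f ht
    have h2 : HasDerivAt (fun t => t ^ a * f (Real.log t)) _ t :=
      (Real.hasDerivAt_rpow_const (p := a) (Or.inl ht.ne')).mul
        ((hasDerivAt_test f (Real.log t)).comp t (Real.hasDerivAt_log ht.ne'))
    rw [h1.deriv_eq, h2.deriv, powLog_apply, powLogFun_of_pos _ _ ht]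
    simp only [map_add, Polynomial.aeval_X, Polynomial.aeval_C, LinearMap.add_apply, add_apply,
      Algebra.algebraMap_eq_smul_one, LinearMap.smul_apply, Module.End.one_apply, smul_apply,
      dir_one_apply, smul_eq_mul]
    rw [Real.rpow_sub_one ht.ne']
    field_simp
    ring

theorem dir_pow_powLog (a : ℝ) (k : ℕ) (f : 𝓓((⊤ : TopologicalSpace.Opens ℝ), ℝ)) :
    (dir ℝ (1 : ℝ) ^ k) (powLog a f) =
      powLog (a - k) (aeval (dir ℝ (1 : ℝ)) (eulerPoly a k) f) := by
  induction k with
  | zero => simp [eulerPoly]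
  | succ k ih =>
    rw [pow_succ', Module.End.mul_apply, ih, dir_powLog, eulerPoly, eulerPoly,
      Finset.prod_range_succ, mul_comm, map_mul]
    push_cast
    rw [← sub_sub]
    rfl

/-- Substitute `t = e^s`: the Jacobian `e^s` cancels `t^(a+b) = e^(-s)`. -/
theorem integral_powLog_mul {a b : ℝ} (hab : a + b = -1)
    (f g : 𝓓((⊤ : TopologicalSpace.Opens ℝ), ℝ)) :
    ∫ t, powLog a f t * powLog b g t = ∫ s, f s * g s := by
  have h1 : ∫ t, powLog a f t * powLog b g t = ∫ t in Ioi 0, powLog a f t * powLog b g t := by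
    refine (setIntegral_eq_integral_of_forall_compl_eq_zero fun t ht => ?_).symm
    rw [powLog_of_nonpos a f (not_lt.mp ht), zero_mul]
  have h2 := integral_image_eq_integral_abs_deriv_smul (s := univ) (f := Real.exp)
    (f' := Real.exp) MeasurableSet.univ (fun x _ => (Real.hasDerivAt_exp x).hasDerivWithinAt)
    Real.exp_injective.injOn (fun t => powLog a f t * powLog b g t)
  rw [image_univ, Real.range_exp, setIntegral_univ] at h2
  rw [h1, h2]
  congr 1
  ext s
  rw [powLog_apply, powLog_apply, powLogFun_of_pos _ _ (Real.exp_pos s),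
    powLogFun_of_pos _ _ (Real.exp_pos s), Real.log_exp, ← Real.exp_mul, ← Real.exp_mul,
    abs_of_pos (Real.exp_pos s), smul_eq_mul]
  have : Real.exp s * Real.exp (s * a) * Real.exp (s * b) = 1 := by
    rw [← Real.exp_add, ← Real.exp_add, show s + s * a + s * b = s * (1 + (a + b)) by ring, hab]
    simp
  linear_combination (f s * g s) * this

theorem powLog_div_pow (a : ℝ) (k : ℕ) (f : 𝓓((⊤ : TopologicalSpace.Opens ℝ), ℝ)) (t : ℝ) :
    powLog a f t / t ^ k = powLog (a - k) f t := by
  rcases le_or_gt t 0 with ht | ht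
  · rw [powLog_of_nonpos _ _ ht, powLog_of_nonpos _ _ ht, zero_div]
  · rw [powLog_apply, powLog_apply, powLogFun_of_pos _ _ ht, powLogFun_of_pos _ _ ht,
      Real.rpow_sub_natCast ht.ne', mul_div_right_comm]

/-- Optimality of the constant on the half-line. -/
theorem le_rellichConst_of_line {m : ℕ} {K c : ℝ}
    (h : ∀ ψ : 𝓓(posReals, ℝ), K * ∫ t, ψ t ^ 2 / t ^ (2 * m) ≤
      (-1) ^ m * c * ∫ t, ψ t * (dir ℝ (1 : ℝ) ^ (2 * m)) ψ t) : K ≤ c * rellichConst m := by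
  let D : Module.End ℝ 𝓓((⊤ : TopologicalSpace.Opens ℝ), ℝ) := dir ℝ (1 : ℝ)
  set q := eulerPoly (m - 1 / 2) (2 * m) with hq
  -- The exponent `m - 1/2` is forced: dividing by `t^(2m)` or differentiating `2m` times lowers one
  -- of the two exponents by `2m`, and their sum must be `-1`.
  have hsum : ((m : ℝ) - 1 / 2) + ((m - 1 / 2) - (2 * m : ℕ)) = -1 := by push_cast; ring
  have h1 : ∀ f : 𝓓((⊤ : TopologicalSpace.Opens ℝ), ℝ), K * ∫ s, f s * f s ≤
      (-1) ^ m * c * ∫ s, f s * aeval D q f s := by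
    intro f
    have h0 := h (powLog (m - 1 / 2) f)
    simp only [dir_pow_powLog, pow_two, mul_div_assoc, powLog_div_pow] at h0
    rwa [integral_powLog_mul hsum, integral_powLog_mul hsum] at h0
  obtain ⟨χ, hχ⟩ := exists_test_pos ℝ
  -- Testing with `s ↦ χ(εs)` replaces `D` by `ε D`; the Jacobian cancels, and as `ε → 0` only the
  -- constant term of `q` contributes.
  have h2 : ∀ ε : ℝ, 0 < ε → K * ∫ s, χ s * χ s ≤
      (-1) ^ m * c * pairing volume χ (aeval (ε • D) q) := by
    intro ε hε
    let S : ℝ ≃L[ℝ] ℝ := ContinuousLinearEquiv.unitsEquivAut ℝ (Units.mk0 ε hε.ne')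
    have hSa : ∀ s, S s = s * ε := fun s => rfl
    have hS : ∀ x, S x ∈ (⊤ : TopologicalSpace.Opens ℝ) → x ∈ (⊤ : TopologicalSpace.Opens ℝ) :=
      fun _ _ => trivial
    obtain ⟨k, hk, hint⟩ := exists_integral_comp_equiv S (volume : Measure ℝ)
    have hd : ∀ f : 𝓓((⊤ : TopologicalSpace.Opens ℝ), ℝ),
        (compEquiv S hS ((ε • D) f) : 𝓓((⊤ : TopologicalSpace.Opens ℝ), ℝ)) =
          D (compEquiv S hS f) := by
      intro f
      rw [← compEquiv_dir, hSa]
      congr 1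
      ext t
      simp [D, dir_eq_fderiv, mul_comm]
    have h3 := h1 (compEquiv S hS χ)
    rw [← intertwine_aeval _ _ _ hd] at h3
    simp only [compEquiv_apply] at h3
    rw [hint (fun s => χ s * χ s), hint (fun s => χ s * aeval (ε • D) q χ s), mul_left_comm,
      mul_left_comm _ k] at h3
    exact le_of_mul_le_mul_left h3 hk
  have hlim := ((tendsto_aeval_smul (pairing volume χ) D q).const_mul ((-1) ^ m * c)).mono_left
    (nhdsWithin_le_nhds (s := Ioi 0))
  have h3 := ge_of_tendsto hlim (by
    filter_upwards [self_mem_nhdsWithin] with ε hε using h2 ε hε)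
  have e : pairing volume χ 1 = ∫ s, χ s * χ s := rfl
  simp only [pow_two] at hχ
  rw [e, ← mul_assoc] at h3
  have h4 := le_of_mul_le_mul_right h3 hχ
  rwa [mul_right_comm, hq, eval_zero_eulerPoly, mul_comm] at h4

/-! ### Passage from the Euclidean to the Finsler weight. -/

section

variable {n m : ℕ} {a : (Fin n → ℕ) → ℝ} {ν : EuclideanSpace ℝ (Fin n)}

theorem setIntegral_halfSpace {g : EuclideanSpace ℝ (Fin n) → ℝ} (u : 𝓓(halfSpace ν, ℝ))
    (hg : ∀ x, u x = 0 → g x = 0) :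
    ∫ x in (halfSpace ν : Set (EuclideanSpace ℝ (Fin n))), g x = ∫ x, g x := by
  refine setIntegral_eq_integral_of_forall_compl_eq_zero fun x hx => hg x ?_
  by_contra h
  exact hx (u.tsupport_subset (subset_tsupport _ h))

theorem sq_div_finslerDist (hν : ‖ν‖ = 1) (u : 𝓓(halfSpace ν, ℝ)) (x : EuclideanSpace ℝ (Fin n))
    (hx : x ∈ (halfSpace ν : Set (EuclideanSpace ℝ (Fin n)))) :
    u x ^ 2 / finslerDist m a (halfSpace ν) x ^ (2 * m) =
      (finslerDist m a (halfSpace ν) ν ^ (2 * m))⁻¹ *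
        (u x ^ 2 / inner ℝ ν x ^ (2 * m)) := by
  rw [finslerDist_eq hν hx, mul_pow, ← div_div, div_eq_inv_mul]

theorem setIntegral_sq_div_finslerDist (hν : ‖ν‖ = 1) (u : 𝓓(halfSpace ν, ℝ)) :
    ∫ x in (halfSpace ν : Set (EuclideanSpace ℝ (Fin n))),
        u x ^ 2 / finslerDist m a (halfSpace ν) x ^ (2 * m) =
      (finslerDist m a (halfSpace ν) ν ^ (2 * m))⁻¹ *
        ∫ x, u x ^ 2 / inner ℝ ν x ^ (2 * m) := by
  rw [setIntegral_congr_fun (halfSpace ν).isOpen.measurableSet (sq_div_finslerDist hν u),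
    integral_const_mul, setIntegral_halfSpace u fun x hx => by simp [hx]]

end

end FinslerRellich

end

theorem theorem2 (n m : ℕ) (hm : 1 ≤ m) (a : (Fin n → ℕ) → ℝ)
    (ha : FinslerRellich.IsElliptic m a) :
    (∀ ν : EuclideanSpace ℝ (Fin n), ‖ν‖ = 1 →
      ∀ u : TestFunction (FinslerRellich.halfSpace ν) ℝ (⊤ : ℕ∞),
        IntegrableOn (fun x => u x * FinslerRellich.operator m a u x)
          (FinslerRellich.halfSpace ν) ∧
        IntegrableOn (fun x => u x ^ 2 /
          FinslerRellich.finslerDist m a (FinslerRellich.halfSpace ν) x ^ (2 * m))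
          (FinslerRellich.halfSpace ν) ∧
        ∫ x in (FinslerRellich.halfSpace ν : Set (EuclideanSpace ℝ (Fin n))),
            u x * FinslerRellich.operator m a u x ≥
          FinslerRellich.rellichConst m *
            ∫ x in (FinslerRellich.halfSpace ν : Set (EuclideanSpace ℝ (Fin n))),
              u x ^ 2 /
                FinslerRellich.finslerDist m a (FinslerRellich.halfSpace ν) x ^ (2 * m)) ∧
    (ConvexOn ℝ univ (FinslerRellich.finsler (n := n) m a) →
      ∀ ν : EuclideanSpace ℝ (Fin n), ‖ν‖ = 1 → ∀ C : ℝ,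
        (∀ u : TestFunction (FinslerRellich.halfSpace ν) ℝ (⊤ : ℕ∞),
          ∫ x in (FinslerRellich.halfSpace ν : Set (EuclideanSpace ℝ (Fin n))),
              u x * FinslerRellich.operator m a u x ≥
            C * ∫ x in (FinslerRellich.halfSpace ν : Set (EuclideanSpace ℝ (Fin n))),
              u x ^ 2 /
                FinslerRellich.finslerDist m a (FinslerRellich.halfSpace ν) x ^ (2 * m)) →
        C ≤ FinslerRellich.rellichConst m) := by
  open FinslerRellich in
  constructor
  · intro ν hν u
    have hν0 : ν ≠ 0 := by rintro rfl; simp at hν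
    refine ⟨(integrable_opIn_mul m a u).integrableOn, ?_, ?_⟩
    · rw [integrableOn_congr_fun (sq_div_finslerDist hν u) (halfSpace ν).isOpen.measurableSet]
      exact ((integrable_sq_div_inner_pow u m).const_mul _).integrableOn
    · rw [setIntegral_sq_div_finslerDist hν u, setIntegral_halfSpace u fun x hx => by simp [hx]]
      refine le_trans ?_ (rellich_halfSpace hν (ha.nonneg hm) (ha ν hν0) u)
      rw [mul_assoc]
      refine mul_le_mul_of_nonneg_left (mul_le_mul_of_nonneg_right ?_ ?_) (rellichConst_pos m).le
      -- The lower bound on `d_H(ν)`, raised to the power `2m`, becomes `d_H(ν)^(-2m) ≤ H(ν)`.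
      · have hF := ha.finsler_pos hν0
        have h1 := pow_le_pow_left₀ (by positivity) (ha.inv_finsler_le_finslerDist hm hν) (2 * m)
        rw [inv_pow, ha.finsler_pow hm] at h1
        exact inv_le_of_inv_le₀ (ha ν hν0) h1
      · exact integral_nonneg fun x => by
          change 0 ≤ u x ^ 2 / _
          rw [pow_mul]; positivity
  · intro hconv ν hν K h
    have hν0 : ν ≠ 0 := by rintro rfl; simp at hν
    have hs := ha ν hν0
    -- By convexity `d_H(ν)^(-2m) = H(ν)`, so no constant is lost in returning to the Euclidean
    -- weight.
    have h1 : ∀ u : TestFunction (halfSpace ν) ℝ (⊤ : ℕ∞),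
        (K * symbol m a ν) * ∫ x, u x ^ 2 / inner ℝ ν x ^ (2 * m) ≤
          ∫ x, u x * operator m a u x := by
      intro u
      have := h u
      rwa [setIntegral_sq_div_finslerDist hν u, setIntegral_halfSpace u fun x hx => by simp [hx],
        ha.finslerDist_normal hm hν hconv, inv_pow, inv_inv, ha.finsler_pow hm, ← mul_assoc,
        ge_iff_le] at this
    have h2 := le_rellichConst_of_line (line_inequality hν h1)
    rw [mul_comm] at h2
    exact le_of_mul_le_mul_left h2 hs
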